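/- Let $\mathfrak X$ be a countably infinite alphabet containing the distinct letters $x,z_1,t_1,z_2,t_2,\dots$, and let words be the elements of the free monoid $\mathfrak X^*$. For a word $\mathbf w$, the factor monoid $M(\mathbf w)$ consists of all factors of $\mathbf w$ together with a zero element $0$; the product of two factors $\mathbf u,\mathbf v$ of $\mathbf w$ is $\mathbf u\mathbf v$ if $\mathbf u\mathbf v$ is a factor of $\mathbf w$, and all other products are $0$. Let $\mathbf M(\mathbf w)$ be the variety of monoids generated by $M(\mathbf w)$. For $n,m\ge 0$ and a permutation $\rho$ of $\{1,\dots,n+m\}$ put $$\mathbf a_{n,m}[\rho]=\Bigl(\prod_{i=1}^{n}z_it_i\Bigr)\,x\,\Bigl(\prod_{i=1}^{n+m}z_{\rho(i)}\Bigr)\,x\,\Bigl(\prod_{i=n+1}^{n+m}t_iz_i\Bigr).$$ Call $\rho$ an $(n,m)$-permutation if, for every $1\le i\le n+m-1$, exactly one of $\rho(i),\rho(i+1)$ is at most $n$. **Proposition.** Let $n,m\ge 0$ be integers with $|n-m|\le 1$ and $(n,m)\ne(0,0)$, and let $\rho$ be an $(n,m)$-permutation. Then the lattice of subvarieties of $\mathbf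 M(\mathbf a_{n,m}[\rho])$, ordered by inclusion, is not distributive. -/

import Mathlib

/-- The countably infinite alphabet, with its letters named `x`, `z₀, z₁, …` and `t₀, t₁, …`. -/
inductive Letter : Type
  | x : Letter
  | z : ℕ → Letter
  | t : ℕ → Letter

/-- Words: elements of the free monoid over the alphabet. -/
abbrev Word : Type := FreeMonoid Letter

/-- The monoid `M` satisfies the identity `u ≈ v`. -/
def SatisfiesIdentity (M : MonCat.{0}) (u v : Word) : Prop :=
  ∀ φ : Letter → M, FreeMonoid.lift φ u = FreeMonoid.lift φ v

/-- The class of all monoids that satisfy every identity of the set `E`. -/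
def modelsOf (E : Set (Word × Word)) : Set MonCat.{0} :=
  {M | ∀ e ∈ E, SatisfiesIdentity M e.1 e.2}

/-- A variety of monoids: a class of monoids that is given by a set of identities. -/
@[ext]
structure MonoidVariety where
  carrier : Set MonCat.{0}
  equational : ∃ E : Set (Word × Word), carrier = modelsOf E

namespace MonoidVariety

/-- Varieties are ordered by inclusion. -/
instance : PartialOrder MonoidVariety :=
  PartialOrder.lift carrier (fun _ _ h => MonoidVariety.ext h)

/-- The meet of a family of varieties is its intersection. -/
instance : InfSet MonoidVariety where
  sInf S :=
    { carrier := {M | ∀ V ∈ S, M ∈ V.carrier}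
      equational := by
        refine ⟨{e | ∃ V ∈ S, ∃ E, V.carrier = modelsOf E ∧ e ∈ E}, ?_⟩
        ext M
        constructor
        · rintro hM e ⟨V, hV, E, hE, he⟩
          have h := hM V hV
          rw [hE] at h
          exact h e he
        · intro hM V hV
          obtain ⟨E, hE⟩ := V.equational
          rw [hE]
          exact fun e he => hM e ⟨V, hV, E, hE, he⟩ }

/-- The lattice of all varieties of monoids under inclusion: the meet is the intersection, and the
join is the smallest variety that contains the given ones. -/
instance : CompleteLattice MonoidVariety :=
  completeLatticeOfInf MonoidVariety (fun _ =>
    ⟨fun V hV _ hM => hM V hV, fun _ hU _ hM _ hV => hU hV hM⟩)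

/-- The variety generated by a monoid: the smallest variety that contains it. -/
def generatedBy (M : MonCat.{0}) : MonoidVariety :=
  sInf {V | M ∈ V.carrier}

/-- The lattice of subvarieties of `V`. -/
abbrev SubvarietyLattice (V : MonoidVariety) : Type 1 := Set.Iic V

end MonoidVariety

/-- The lattice `L` is distributive. -/
def IsDistributiveLattice (L : Type*) [Lattice L] : Prop :=
  ∀ a b c : L, (a ⊔ b) ⊓ c = (a ⊓ c) ⊔ (b ⊓ c)

/-- The word `u` is a factor of some word of `W`. -/
def IsFactorOf (W : Set Word) (u : Word) : Prop :=
  ∃ w ∈ W, ∃ a b : Word, w = a * u * b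

/-- The underlying set of the factor monoid `M(W)`: the factors of the words of `W`, and a further
element `none`, the zero. -/
def FactorMonoid (W : Set Word) : Type := Option {u : Word // IsFactorOf W u}

namespace FactorMonoid

variable {W : Set Word}

/-- The word `u` as an element of `M(W)`: itself if it is a factor of a word of `W`, and the zero
otherwise. -/
noncomputable def ofWord (W : Set Word) (u : Word) : FactorMonoid W :=
  open scoped Classical in if h : IsFactorOf W u then some ⟨u, h⟩ else none

/-- `u · v = uv` if `uv` is a factor of a word of `W`, and all other products are zero. -/
noncomputable def mul : FactorMonoid W → FactorMonoid W → FactorMonoid W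
  | some u, some v => ofWord W (u.1 * v.1)
  | _, _ => none

theorem ofWord_of_isFactorOf {u : Word} (h : IsFactorOf W u) :
    ofWord W u = some ⟨u, h⟩ := dif_pos h

theorem ofWord_of_not {u : Word} (h : ¬ IsFactorOf W u) : ofWord W u = none := dif_neg h

theorem isFactorOf_left {u v : Word} (h : IsFactorOf W (u * v)) : IsFactorOf W u := by
  obtain ⟨w, hw, a, b, rfl⟩ := h
  exact ⟨_, hw, a, v * b, by simp only [mul_assoc]⟩

theorem isFactorOf_right {u v : Word} (h : IsFactorOf W (u * v)) : IsFactorOf W v := by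
  obtain ⟨w, hw, a, b, rfl⟩ := h
  exact ⟨_, hw, a * u, b, by simp only [mul_assoc]⟩

theorem mul_ofWord (u v : Word) : mul (ofWord W u) (ofWord W v) = ofWord W (u * v) := by
  by_cases hu : IsFactorOf W u
  · by_cases hv : IsFactorOf W v
    · rw [ofWord_of_isFactorOf hu, ofWord_of_isFactorOf hv]; rfl
    · rw [ofWord_of_not hv, ofWord_of_not (fun h => hv (isFactorOf_right h)),
        ofWord_of_isFactorOf hu]; rfl
  · rw [ofWord_of_not hu, ofWord_of_not (fun h => hu (isFactorOf_left h))]; rfl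

theorem eq_none_or_ofWord (a : FactorMonoid W) : a = none ∨ ∃ u, a = ofWord W u := by
  rcases a with _ | ⟨u, hu⟩
  · exact Or.inl rfl
  · exact Or.inr ⟨u, (ofWord_of_isFactorOf hu).symm⟩

theorem none_mul (a : FactorMonoid W) : mul none a = none := rfl

theorem mul_none (a : FactorMonoid W) : mul a none = none := by
  rcases a with _ | _ <;> rfl

noncomputable instance : Monoid (FactorMonoid W) where
  mul := mul
  one := ofWord W 1
  one_mul a := by
    change mul (ofWord W 1) a = a
    rcases eq_none_or_ofWord a with rfl | ⟨u, rfl⟩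
    · exact mul_none _
    · rw [mul_ofWord, one_mul]
  mul_one a := by
    change mul a (ofWord W 1) = a
    rcases eq_none_or_ofWord a with rfl | ⟨u, rfl⟩
    · rfl
    · rw [mul_ofWord, mul_one]
  mul_assoc a b c := by
    change mul (mul a b) c = mul a (mul b c)
    rcases eq_none_or_ofWord a with rfl | ⟨u, rfl⟩
    · rfl
    · rcases eq_none_or_ofWord b with rfl | ⟨v, rfl⟩
      · rw [none_mul, mul_none, none_mul]
      · rcases eq_none_or_ofWord c with rfl | ⟨w, rfl⟩
        · rw [mul_none, mul_none, mul_none]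
        · simp only [mul_ofWord, mul_assoc]

end FactorMonoid

/-- The word
`a_{n,m}[ρ] = (∏_{i=1}^{n} z_i t_i) x (∏_{i=1}^{n+m} z_{ρ(i)}) x (∏_{i=n+1}^{n+m} t_i z_i)`,
with all indices shifted by one, so that they start at `0`. -/
def aWord (n m : ℕ) (ρ : Equiv.Perm (Fin (n + m))) : Word :=
  (List.ofFn fun i : Fin n => FreeMonoid.of (Letter.z i) * FreeMonoid.of (Letter.t i)).prod
    * FreeMonoid.of Letter.x
    * (List.ofFn fun i : Fin (n + m) => FreeMonoid.of (Letter.z (ρ i))).prod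
    * FreeMonoid.of Letter.x
    * (List.ofFn fun j : Fin m =>
        FreeMonoid.of (Letter.t (n + j)) * FreeMonoid.of (Letter.z (n + j))).prod

/-- `(n,m)`-permutations: of any two consecutive values, exactly one is among the first `n`
indices (which are `0, …, n - 1` here). -/
def IsNMPermutation (n m : ℕ) (ρ : Equiv.Perm (Fin (n + m))) : Prop :=
  ∀ i j : Fin (n + m), (j : ℕ) = i + 1 →
    ((ρ i : ℕ) < n ∧ n ≤ (ρ j : ℕ)) ∨ ((ρ j : ℕ) < n ∧ n ≤ (ρ i : ℕ))

/-! Write `w` for the given word. Distributivity is refuted by three subvarieties: `A` and `B`,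
generated by the syntactic monoids of two finite languages `Lα` and `Lβ`, and `C`, generated by the
factor monoid of a word `f` with `Lα ∩ Lβ = {f}`. If an identity holds in `A` and `B`, replacing one
side by the other under a substitution and inside a context never leaves `Lα` or `Lβ`, hence fixes
`f`; so `C ≤ A ⊔ B`. On the other hand `A` satisfies `f ≈ g`, `B` satisfies `f ≈ h`, and `C`
satisfies `g ≈ f₀ ≈ h`. Thus both `A ⊓ C` and `B ⊓ C`, and with them their join, satisfy `f ≈ f₀`,
whereas `C = (A ⊔ B) ⊓ C` does not. This is `not_isDistributiveLattice_of_languages`.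

The word `f` has the shape of `w`, with a longer main block `x Z x`. The words of `Lα` arise by
moving the first `x` to the right over at most two letters, those of `Lβ` by moving the second `x`
to the left over at most two letters; `g` and `h` are the extreme words, and `f₀` is `x x` followed
by `f` without its two `x`. Three facts are needed.

Identities of `M(w)` preserve `Lα` and `Lβ` (`leftLanguage_closed`, `rightLanguage_closed`), which
places `A` and `B` below the variety of `M(w)`. The word without `x` is an isoterm for `M(w)`
(`frame_rigid`): it is determined by its restrictions to consecutive letters, and `w` has factors
that detect each of these. The position of `x` is controlled by markers, letters of `f` that survive
in some renaming of `f` to `w`.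

The identity `f ≈ g` holds in `A` (`leftLanguage_substitution`), and dually `f ≈ h` in `B`. A
substitution that keeps `x` and sends `f` into `Lα` must map the main block almost identically;
shifts of the block are excluded because its first letters come from alternating sides of the frame
and those from one side appear in a permuted order (`IsRigidStart`).

Finally, `C` satisfies `g ≈ f₀` and `h ≈ f₀` because no substitution that keeps `x` sends either
side to a factor of `f` (`isIdentityOf_of_shorter`). The word `f` itself is obtained by adding six
letters at each end of the main block of `w` (`enlarge`, `enlargeSide`). -/

/-! ### Identities of factor monoids and of syntactic monoids -/

/-- Every substitution that sends one of `u`, `v` to a factor of `w` identifies them; this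
describes the identities of the factor monoid of `w`. -/
def IsIdentityOf (w u v : List Letter) : Prop :=
  ∀ φ : Letter → List Letter,
    (u.flatMap φ <:+: w ∨ v.flatMap φ <:+: w) → u.flatMap φ = v.flatMap φ

theorem toList_lift (φ : Letter → Word) (u : Word) :
    (FreeMonoid.lift φ u).toList = u.toList.flatMap (fun l => (φ l).toList) := by
  induction u using FreeMonoid.recOn with
  | one => simp
  | of_mul a u ih => simp [ih]

theorem isFactorOf_singleton {w u : Word} :
    IsFactorOf {w} u ↔ u.toList <:+: w.toList := by
  constructor
  · rintro ⟨_, rfl, a, b, rfl⟩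
    exact ⟨a.toList, b.toList, by simp⟩
  · rintro ⟨a, b, h⟩
    refine ⟨w, rfl, FreeMonoid.ofList a, FreeMonoid.ofList b, ?_⟩
    apply FreeMonoid.toList.injective
    simp [← h]

namespace FactorMonoid

theorem ofWord_eq_ofWord_iff {W : Set Word} {u v : Word} :
    ofWord W u = ofWord W v ↔ (IsFactorOf W u ∨ IsFactorOf W v → u = v) := by
  by_cases hu : IsFactorOf W u <;> by_cases hv : IsFactorOf W v
  · rw [ofWord_of_isFactorOf hu, ofWord_of_isFactorOf hv]
    constructor
    · intro h _
      have := Option.some.inj h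
      exact congrArg Subtype.val this
    · intro h
      have := h (Or.inl hu)
      subst this
      rfl
  · rw [ofWord_of_isFactorOf hu, ofWord_of_not hv]
    refine ⟨fun h => absurd h (Option.some_ne_none _), fun h => ?_⟩
    have := h (Or.inl hu)
    subst this
    exact absurd hu hv
  · rw [ofWord_of_isFactorOf hv, ofWord_of_not hu]
    refine ⟨fun h => absurd h.symm (Option.some_ne_none _), fun h => ?_⟩
    have := h (Or.inr hv)
    subst this
    exact absurd hv hu
  · rw [ofWord_of_not hu, ofWord_of_not hv]
    exact ⟨fun _ h => (h.elim hu hv).elim, fun _ => rfl⟩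

/-- The canonical homomorphism from words onto the factor monoid. -/
noncomputable def ofWordHom (W : Set Word) : Word →* FactorMonoid W where
  toFun := ofWord W
  map_one' := rfl
  map_mul' u v := (mul_ofWord u v).symm

theorem ofWord_surjective (w : Word) : Function.Surjective (ofWord {w}) := by
  intro a
  rcases eq_none_or_ofWord a with rfl | ⟨u, rfl⟩
  -- The zero is the image of any word longer than `w`.
  · refine ⟨w * FreeMonoid.of Letter.x, ofWord_of_not ?_⟩
    rw [isFactorOf_singleton]
    intro h
    have := h.length_le
    simp at this
  · exact ⟨u, rfl⟩

end FactorMonoid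

/-- Every assignment of letters to elements of the factor monoid lifts along the surjection from
words, so it suffices to consider substitutions; two words have the same image exactly if they are
equal or both fail to be factors of `w`. -/
theorem satisfiesIdentity_factorMonoid {w : Word} {u v : Word} :
    SatisfiesIdentity (MonCat.of (FactorMonoid {w})) u v ↔
      IsIdentityOf w.toList u.toList v.toList := by
  have key : ∀ (ψ : Letter → Word) (u : Word),
      FreeMonoid.lift (fun l => FactorMonoid.ofWordHom {w} (ψ l)) u =
        FactorMonoid.ofWord {w} (FreeMonoid.lift ψ u) := by
    intro ψ u
    have : FreeMonoid.lift (fun l => FactorMonoid.ofWordHom {w} (ψ l)) =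
        (FactorMonoid.ofWordHom {w}).comp (FreeMonoid.lift ψ) := by
      ext l; simp
    rw [this]; rfl
  constructor
  · intro h φ hφ
    have h1 := h (fun l => FactorMonoid.ofWordHom {w} (FreeMonoid.ofList (φ l)))
    erw [key, key] at h1
    rw [FactorMonoid.ofWord_eq_ofWord_iff, isFactorOf_singleton, isFactorOf_singleton,
      toList_lift, toList_lift] at h1
    have := congrArg FreeMonoid.toList (h1 hφ)
    rwa [toList_lift, toList_lift] at this
  · intro h φ
    choose ψ hψ using fun l => FactorMonoid.ofWord_surjective w (φ l)
    have hφ : φ = fun l => FactorMonoid.ofWordHom {w} (ψ l) := by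
      funext l; exact (hψ l).symm
    rw [hφ]
    erw [key, key]
    rw [FactorMonoid.ofWord_eq_ofWord_iff, isFactorOf_singleton, isFactorOf_singleton]
    intro h1
    apply FreeMonoid.toList.injective
    rw [toList_lift, toList_lift] at *
    exact h _ h1

/-- The syntactic congruence of a set of words. -/
def syntacticCon (L : Set (List Letter)) : Con Word where
  r u v := ∀ p q : List Letter, p ++ u.toList ++ q ∈ L ↔ p ++ v.toList ++ q ∈ L
  iseqv := ⟨fun _ _ _ => Iff.rfl, fun h p q => (h p q).symm,
    fun h h' p q => (h p q).trans (h' p q)⟩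
  mul' := by
    intro a b c d hab hcd p q
    have h1 := hab p (c.toList ++ q)
    have h2 := hcd (p ++ b.toList) q
    simp only [FreeMonoid.toList_mul, List.append_assoc] at *
    exact h1.trans h2

theorem satisfiesIdentity_syntacticCon {L : Set (List Letter)} {u v : Word} :
    SatisfiesIdentity (MonCat.of (syntacticCon L).Quotient) u v ↔
      ∀ (φ : Letter → List Letter) (p q : List Letter),
        p ++ u.toList.flatMap φ ++ q ∈ L ↔ p ++ v.toList.flatMap φ ++ q ∈ L := by
  have key : ∀ (ψ : Letter → Word) (u : Word),
      FreeMonoid.lift (fun l => (syntacticCon L).mk' (ψ l)) u =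
        (syntacticCon L).mk' (FreeMonoid.lift ψ u) := by
    intro ψ u
    have : FreeMonoid.lift (fun l => (syntacticCon L).mk' (ψ l)) =
        ((syntacticCon L).mk').comp (FreeMonoid.lift ψ) := by
      ext l; simp
    rw [this]; rfl
  constructor
  · intro h φ p q
    have h1 := h (fun l => (syntacticCon L).mk' (FreeMonoid.ofList (φ l)))
    erw [key, key] at h1
    have h2 := (Con.eq (syntacticCon L)).1 h1 p q
    rwa [toList_lift, toList_lift] at h2
  · intro h φ
    choose ψ hψ using fun l => (syntacticCon L).mk'_surjective (φ l)
    have hφ : φ = fun l => (syntacticCon L).mk' (ψ l) := by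
      funext l; exact (hψ l).symm
    rw [hφ]
    erw [key, key]
    refine (Con.eq (syntacticCon L)).2 fun p q => ?_
    rw [toList_lift, toList_lift]
    exact h _ p q

/-! ### Non-distributivity from two languages -/

namespace MonoidVariety

theorem self_mem_generatedBy (M : MonCat.{0}) : M ∈ (generatedBy M).carrier :=
  fun _ h => h

theorem generatedBy_le {M : MonCat.{0}} {V : MonoidVariety} :
    generatedBy M ≤ V ↔ M ∈ V.carrier :=
  ⟨fun h => h (self_mem_generatedBy M), fun h _ hN => hN V h⟩

/-- The Galois connection between varieties and identities: inclusions of varieties can be checked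
on identities. -/
theorem mem_iff_forall_identity {M : MonCat.{0}} {V : MonoidVariety} :
    M ∈ V.carrier ↔ ∀ u v : Word, (∀ N ∈ V.carrier, SatisfiesIdentity N u v) →
      SatisfiesIdentity M u v := by
  constructor
  · intro h u v huv
    exact huv M h
  · intro h
    obtain ⟨E, hE⟩ := V.equational
    rw [hE]
    intro e he
    refine h _ _ fun N hN => ?_
    rw [hE] at hN
    exact hN e he

/-- The variety defined by a single identity. -/
def ofIdentity (u v : Word) : MonoidVariety := ⟨modelsOf {(u, v)}, _, rfl⟩

theorem mem_ofIdentity {M : MonCat.{0}} {u v : Word} :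
    M ∈ (ofIdentity u v).carrier ↔ SatisfiesIdentity M u v := by
  simp [ofIdentity, modelsOf]

end MonoidVariety

open MonoidVariety in
/-- The syntactic monoids of `Lα` and `Lβ` and the factor monoid of `f` generate three
subvarieties that violate distributivity. -/
theorem not_isDistributiveLattice_of_languages {w : Word} {f g h f₀ : List Letter}
    {Lα Lβ : Set (List Letter)} (hfα : f ∈ Lα) (hfβ : f ∈ Lβ)
    (hinter : ∀ u, u ∈ Lα → u ∈ Lβ → u = f)
    (hΘα : ∀ u v, u ∈ Lα → IsIdentityOf w.toList u v → v ∈ Lα)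
    (hΘβ : ∀ u v, u ∈ Lβ → IsIdentityOf w.toList u v → v ∈ Lβ)
    (hα : ∀ (φ : Letter → List Letter) (p q : List Letter),
      p ++ f.flatMap φ ++ q ∈ Lα ↔ p ++ g.flatMap φ ++ q ∈ Lα)
    (hβ : ∀ (φ : Letter → List Letter) (p q : List Letter),
      p ++ f.flatMap φ ++ q ∈ Lβ ↔ p ++ h.flatMap φ ++ q ∈ Lβ)
    (hg : IsIdentityOf f g f₀) (hh : IsIdentityOf f h f₀) (hne : f ≠ f₀) :
    ¬ IsDistributiveLattice (SubvarietyLattice (generatedBy (MonCat.of (FactorMonoid {w})))) := by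
  intro hd
  have hL : ∀ L : Set (List Letter), (∀ u v, u ∈ L → IsIdentityOf w.toList u v → v ∈ L) →
      generatedBy (MonCat.of (syntacticCon L).Quotient) ≤
        generatedBy (MonCat.of (FactorMonoid {w})) := by
    intro L hL
    rw [generatedBy_le, mem_iff_forall_identity]
    intro u v huv
    have h1 := satisfiesIdentity_factorMonoid.1 (huv _ (self_mem_generatedBy _))
    rw [satisfiesIdentity_syntacticCon]
    -- Identities of the factor monoid form a fully invariant congruence, so closure of `L` under
    -- them already covers substitutions and contexts.
    have h2 : ∀ {u v : List Letter}, IsIdentityOf w.toList u v →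
        ∀ (φ : Letter → List Letter) (p q : List Letter),
        IsIdentityOf w.toList (p ++ u.flatMap φ ++ q) (p ++ v.flatMap φ ++ q) := by
      intro u v h φ p q ψ hψ
      simp only [List.flatMap_append, List.flatMap_assoc] at *
      rw [h (fun l => (φ l).flatMap ψ)]
      refine hψ.imp ?_ ?_ <;>
      · rintro ⟨a, b, hab⟩
        exact ⟨a ++ p.flatMap ψ, q.flatMap ψ ++ b, by simpa using hab⟩
    have h3 : IsIdentityOf w.toList v.toList u.toList := fun φ hφ => (h1 φ hφ.symm).symm
    exact fun φ p q => ⟨fun hu => hL _ _ hu (h2 h1 φ p q), fun hv => hL _ _ hv (h2 h3 φ p q)⟩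
  set A := generatedBy (MonCat.of (syntacticCon Lα).Quotient)
  set B := generatedBy (MonCat.of (syntacticCon Lβ).Quotient)
  set C := generatedBy (MonCat.of (FactorMonoid {FreeMonoid.ofList f}))
  set V := generatedBy (MonCat.of (FactorMonoid {w}))
  have hA : A ≤ V := hL _ hΘα
  have hB : B ≤ V := hL _ hΘβ
  -- If a context and a substitution turn one side of an identity of `A` and `B` into `f`, they turn
  -- the other side into a word of both languages, which is again `f`.
  have hC : C ≤ A ⊔ B := by
    rw [generatedBy_le, mem_iff_forall_identity]
    intro u v huv
    have hu1 := satisfiesIdentity_syntacticCon.1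
      (huv _ ((le_sup_left : A ≤ A ⊔ B) (self_mem_generatedBy _)))
    have hu2 := satisfiesIdentity_syntacticCon.1
      (huv _ ((le_sup_right : B ≤ A ⊔ B) (self_mem_generatedBy _)))
    rw [satisfiesIdentity_factorMonoid]
    rintro φ (⟨p, q, hpq⟩ | ⟨p, q, hpq⟩)
    · change _ = f at hpq
      have e1 := (hu1 φ p q).1 (by rwa [hpq])
      have e2 := (hu2 φ p q).1 (by rwa [hpq])
      have := hinter _ e1 e2
      rw [← hpq] at this
      simpa using this.symm
    · change _ = f at hpq
      have e1 := (hu1 φ p q).2 (by rwa [hpq])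
      have e2 := (hu2 φ p q).2 (by rwa [hpq])
      have := hinter _ e1 e2
      rw [← hpq] at this
      simpa using this
  have hfg : ∀ N ∈ A.carrier, SatisfiesIdentity N (FreeMonoid.ofList f) (FreeMonoid.ofList g) := by
    have : A ≤ ofIdentity (FreeMonoid.ofList f) (FreeMonoid.ofList g) := by
      rw [generatedBy_le, mem_ofIdentity, satisfiesIdentity_syntacticCon]
      exact hα
    exact fun N hN => mem_ofIdentity.1 (this hN)
  have hfh : ∀ N ∈ B.carrier, SatisfiesIdentity N (FreeMonoid.ofList f) (FreeMonoid.ofList h) := by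
    have : B ≤ ofIdentity (FreeMonoid.ofList f) (FreeMonoid.ofList h) := by
      rw [generatedBy_le, mem_ofIdentity, satisfiesIdentity_syntacticCon]
      exact hβ
    exact fun N hN => mem_ofIdentity.1 (this hN)
  have hCg : ∀ g', IsIdentityOf f g' f₀ → ∀ N ∈ C.carrier,
      SatisfiesIdentity N (FreeMonoid.ofList g') (FreeMonoid.ofList f₀) := by
    intro g' hg'
    have : C ≤ ofIdentity (FreeMonoid.ofList g') (FreeMonoid.ofList f₀) := by
      rw [generatedBy_le, mem_ofIdentity, satisfiesIdentity_factorMonoid]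
      exact hg'
    exact fun N hN => mem_ofIdentity.1 (this hN)
  have hCV : C ≤ V := hC.trans (sup_le hA hB)
  have hd' : (A ⊔ B) ⊓ C = (A ⊓ C) ⊔ (B ⊓ C) :=
    congrArg Subtype.val (hd ⟨A, hA⟩ ⟨B, hB⟩ ⟨C, hCV⟩)
  have hle : (A ⊓ C) ⊔ (B ⊓ C) ≤ ofIdentity (FreeMonoid.ofList f) (FreeMonoid.ofList f₀) := by
    apply sup_le
    · intro N hN
      rw [mem_ofIdentity]
      exact fun φ => (hfg N ((inf_le_left : A ⊓ C ≤ A) hN) φ).trans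
        (hCg g hg N ((inf_le_right : A ⊓ C ≤ C) hN) φ)
    · intro N hN
      rw [mem_ofIdentity]
      exact fun φ => (hfh N ((inf_le_left : B ⊓ C ≤ B) hN) φ).trans
        (hCg h hh N ((inf_le_right : B ⊓ C ≤ C) hN) φ)
  have hmem : C ≤ ofIdentity (FreeMonoid.ofList f) (FreeMonoid.ofList f₀) :=
    (le_inf hC le_rfl).trans (hd'.le.trans hle)
  -- The identity substitution separates `f` from `f₀` in the factor monoid of `f`.
  rw [generatedBy_le, mem_ofIdentity, satisfiesIdentity_factorMonoid] at hmem
  apply hne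
  have := hmem (fun l => [l]) (Or.inl (by simp))
  simpa using this

/-! ### Sandwich words and their factors -/

noncomputable instance : DecidableEq Letter := Classical.decEq _

/-- The word `∏ z_i` over a list of indices. -/
def zWord (Z : List ℕ) : List Letter := Z.map Letter.z

/-- The word `∏ z_i t_i` over a list of indices. -/
def ztWord (A : List ℕ) : List Letter := A.flatMap fun i => [Letter.z i, Letter.t i]

/-- The word `∏ t_i z_i` over a list of indices. -/
def tzWord (B : List ℕ) : List Letter := B.flatMap fun i => [Letter.t i, Letter.z i]

/-- The word `(∏ z_i t_i) c (∏ t_i z_i)`. -/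
def frame (A B : List ℕ) (c : List Letter) : List Letter := ztWord A ++ c ++ tzWord B

/-- The frame around a main block that contains the letter `x` twice. -/
def sandwich (A B X₁ Y X₂ : List ℕ) : List Letter :=
  frame A B (zWord X₁ ++ Letter.x :: (zWord Y ++ Letter.x :: zWord X₂))

section basic

variable {A B Z X Y : List ℕ} {i : ℕ}

@[simp] theorem zWord_nil : zWord [] = [] := rfl
@[simp] theorem zWord_cons : zWord (i :: Z) = Letter.z i :: zWord Z := rfl
@[simp] theorem zWord_append : zWord (X ++ Y) = zWord X ++ zWord Y := List.map_append
@[simp] theorem length_zWord : (zWord Z).length = Z.length := List.length_map _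
@[simp] theorem ztWord_nil : ztWord [] = [] := rfl
@[simp] theorem ztWord_cons : ztWord (i :: Z) = Letter.z i :: Letter.t i :: ztWord Z := rfl
@[simp] theorem ztWord_append : ztWord (X ++ Y) = ztWord X ++ ztWord Y := List.flatMap_append
@[simp] theorem tzWord_nil : tzWord [] = [] := rfl
@[simp] theorem tzWord_cons : tzWord (i :: Z) = Letter.t i :: Letter.z i :: tzWord Z := rfl
@[simp] theorem tzWord_append : tzWord (X ++ Y) = tzWord X ++ tzWord Y := List.flatMap_append

@[simp] theorem mem_zWord : Letter.z i ∈ zWord Z ↔ i ∈ Z := by simp [zWord]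
@[simp] theorem t_notMem_zWord : Letter.t i ∉ zWord Z := by simp [zWord]
@[simp] theorem x_notMem_zWord : Letter.x ∉ zWord Z := by simp [zWord]
@[simp] theorem mem_ztWord : Letter.z i ∈ ztWord Z ↔ i ∈ Z := by simp [ztWord]
@[simp] theorem t_mem_ztWord : Letter.t i ∈ ztWord Z ↔ i ∈ Z := by simp [ztWord]
@[simp] theorem x_notMem_ztWord : Letter.x ∉ ztWord Z := by simp [ztWord]
@[simp] theorem mem_tzWord : Letter.z i ∈ tzWord Z ↔ i ∈ Z := by simp [tzWord]
@[simp] theorem t_mem_tzWord : Letter.t i ∈ tzWord Z ↔ i ∈ Z := by simp [tzWord]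
@[simp] theorem x_notMem_tzWord : Letter.x ∉ tzWord Z := by simp [tzWord]

theorem reverse_zWord : (zWord Z).reverse = zWord Z.reverse := by simp [zWord]

theorem reverse_ztWord : (ztWord Z).reverse = tzWord Z.reverse := by
  induction Z with
  | nil => rfl
  | cons a Z ih => simp [ih]

theorem reverse_tzWord : (tzWord Z).reverse = ztWord Z.reverse := by
  rw [← Z.reverse_reverse, ← reverse_ztWord]; simp

theorem reverse_sandwich {X₁ X₂ : List ℕ} : (sandwich A B X₁ Y X₂).reverse =
    sandwich B.reverse A.reverse X₂.reverse Y.reverse X₁.reverse := by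
  simp [sandwich, frame, reverse_zWord, reverse_ztWord, reverse_tzWord]

@[simp] theorem count_z_zWord : (zWord Z).count (Letter.z i) = Z.count i :=
  List.count_map_of_injective _ _ (fun _ _ h => Letter.z.inj h) _

@[simp] theorem count_t_zWord : (zWord Z).count (Letter.t i) = 0 := by
  simp [List.count_eq_zero]

@[simp] theorem count_x_zWord : (zWord Z).count Letter.x = 0 := by
  simp [List.count_eq_zero]

@[simp] theorem count_z_ztWord : (ztWord Z).count (Letter.z i) = Z.count i := by
  induction Z with
  | nil => rfl
  | cons a Z ih => simp [ih, List.count_cons]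

@[simp] theorem count_t_ztWord : (ztWord Z).count (Letter.t i) = Z.count i := by
  induction Z with
  | nil => rfl
  | cons a Z ih => simp [ih, List.count_cons]

@[simp] theorem count_x_ztWord : (ztWord Z).count Letter.x = 0 := by
  simp [List.count_eq_zero]

@[simp] theorem count_z_tzWord : (tzWord Z).count (Letter.z i) = Z.count i := by
  induction Z with
  | nil => rfl
  | cons a Z ih => simp [ih, List.count_cons]

@[simp] theorem count_t_tzWord : (tzWord Z).count (Letter.t i) = Z.count i := by
  induction Z with
  | nil => rfl
  | cons a Z ih => simp [ih, List.count_cons]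

@[simp] theorem count_x_tzWord : (tzWord Z).count Letter.x = 0 := by
  simp [List.count_eq_zero]

end basic

/-- The indices of the letters before and after the main block, together, are those inside it. -/
structure BlockBalanced (A B Z : List ℕ) : Prop where
  nodup : Z.Nodup
  perm : Z.Perm (A ++ B)

namespace BlockBalanced

variable {A B Z X₁ Y X₂ : List ℕ} {i : ℕ}

theorem mem_iff (h : BlockBalanced A B Z) : i ∈ Z ↔ i ∈ A ∨ i ∈ B := by
  rw [h.perm.mem_iff, List.mem_append]

theorem count_add (h : BlockBalanced A B Z) (hi : i ∈ Z) : A.count i + B.count i = 1 := by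
  rw [← List.count_append, ← h.perm.count_eq, List.count_eq_one_of_mem h.nodup hi]

theorem count_add_le (h : BlockBalanced A B Z) : A.count i + B.count i ≤ 1 := by
  rw [← List.count_append, ← h.perm.count_eq]
  exact List.nodup_iff_count_le_one.1 h.nodup i

theorem not_mem_both (h : BlockBalanced A B Z) (hA : i ∈ A) (hB : i ∈ B) : False := by
  have h1 := List.count_pos_iff.2 hA
  have h2 := List.count_pos_iff.2 hB
  have := h.count_add_le (i := i)
  omega

theorem nodup_left (h : BlockBalanced A B Z) : A.Nodup :=
  List.nodup_iff_count_le_one.2 fun i => by have := h.count_add_le (i := i); omega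

theorem nodup_right (h : BlockBalanced A B Z) : B.Nodup :=
  List.nodup_iff_count_le_one.2 fun i => by have := h.count_add_le (i := i); omega

theorem reverse (h : BlockBalanced A B Z) : BlockBalanced B.reverse A.reverse Z.reverse where
  nodup := List.nodup_reverse.2 h.nodup
  perm := by
    rw [← List.reverse_append]
    exact (List.reverse_perm _).trans (h.perm.trans (List.reverse_perm _).symm)

end BlockBalanced

/-- A factor of length at least two without linear letters does not meet the left side of the frame. -/
theorem localize_left {A : List ℕ} {V₁ V₂ R D : List Letter}
    (h : V₁ ++ (V₂ ++ R) = ztWord A ++ D) (ht : ∀ i, Letter.t i ∉ V₂) (hl : 2 ≤ V₂.length) :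
    ∃ s, V₁ = ztWord A ++ s ∧ D = s ++ (V₂ ++ R) := by
  induction A generalizing V₁ with
  | nil => exact ⟨V₁, by simp, by simpa using h.symm⟩
  | cons i A ih =>
    -- Every second letter of `ztWord` is linear and so is its last letter; two consecutive places
    -- starting inside it always include one.
    rcases V₁ with _ | ⟨l, _ | ⟨l', V₁⟩⟩
    · rcases V₂ with _ | ⟨a, _ | ⟨b, V₂⟩⟩
      · simp at hl
      · simp at hl
      · simp only [List.nil_append, List.cons_append, ztWord_cons, List.cons.injEq] at h
        exact absurd (by simp [h.2.1]) (ht i)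
    · rcases V₂ with _ | ⟨a, V₂⟩
      · simp at hl
      · simp only [List.nil_append, List.cons_append, ztWord_cons, List.cons.injEq] at h
        exact absurd (by simp [h.2.1]) (ht i)
    · simp only [List.cons_append, ztWord_cons, List.cons.injEq] at h
      obtain ⟨rfl, rfl, h⟩ := h
      obtain ⟨s, rfl, hs⟩ := ih h
      exact ⟨s, by simp, hs⟩

/-- A factor of length at least two without linear letters lies in the main block. -/
theorem localize {A B : List ℕ} {V₁ V₂ V₃ c : List Letter}
    (h : V₁ ++ V₂ ++ V₃ = frame A B c) (ht : ∀ i, Letter.t i ∉ V₂) (hl : 2 ≤ V₂.length) :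
    ∃ s₁ s₂, V₁ = ztWord A ++ s₁ ∧ V₃ = s₂ ++ tzWord B ∧ c = s₁ ++ V₂ ++ s₂ := by
  rw [frame, List.append_assoc, List.append_assoc] at h
  obtain ⟨s₁, rfl, h1⟩ := localize_left h ht hl
  have h2 : V₃.reverse ++ (V₂.reverse ++ s₁.reverse) = ztWord B.reverse ++ c.reverse := by
    rw [← reverse_tzWord]
    simpa using (congrArg List.reverse h1).symm
  obtain ⟨s₂, h3, h4⟩ := localize_left h2 (by simpa using ht) (by simpa using hl)
  refine ⟨s₁, s₂.reverse, rfl, ?_, ?_⟩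
  · rw [← reverse_tzWord] at h3
    simpa using congrArg List.reverse h3
  · simpa using congrArg List.reverse h4

/-! ### Substitutions between sandwich words over the same frame -/

section sandwich

variable {A B Z X₁ Y X₂ X₁' Y' X₂' : List ℕ}

theorem count_t_sandwich_le (hB : BlockBalanced A B Z) (i : ℕ) :
    (sandwich A B X₁ Y X₂).count (Letter.t i) ≤ 1 := by
  have := hB.count_add_le (i := i)
  simp [sandwich, frame]
  omega

theorem count_x_sandwich : (sandwich A B X₁ Y X₂).count Letter.x = 2 := by
  simp [sandwich, frame]

/-- Linear letters do not repeat, so `s` avoids them. If `s` had length at least two, both of its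
copies would lie in the main block, where each `z` occurs only once; `s` would then be a power of
`x`, and two disjoint copies need at least four `x`. -/
theorem repeated_factor_sandwich (hB : BlockBalanced A B Z) (hZ : X₁ ++ Y ++ X₂ = Z)
    {a b c s : List Letter} (h : a ++ s ++ b ++ s ++ c = sandwich A B X₁ Y X₂) :
    (∀ i, Letter.t i ∉ s) ∧ s.length ≤ 1 := by
  have ht : ∀ i, Letter.t i ∉ s := by
    intro i hi
    have h1 := count_t_sandwich_le (X₁ := X₁) (Y := Y) (X₂ := X₂) hB i
    rw [← h] at h1
    have := List.count_pos_iff.2 hi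
    simp at h1
    omega
  refine ⟨ht, ?_⟩
  by_contra hl
  push Not at hl
  obtain ⟨s₁, s₂, rfl, -, -⟩ := localize (V₁ := a) (V₂ := s) (V₃ := b ++ s ++ c)
    (by rw [sandwich] at h; rw [← h]; simp) ht hl
  -- Localizing the second copy as well puts both copies, disjointly, into the main block.
  obtain ⟨s₁', s₂', h1, rfl, h2⟩ := localize (V₁ := ztWord A ++ s₁ ++ s ++ b) (V₂ := s) (V₃ := c)
    h ht hl
  have h3 : s₁' = s₁ ++ s ++ b := by
    simp only [List.append_assoc, List.append_cancel_left_eq] at h1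
    simp [h1]
  subst h3
  have hx : ∀ l ∈ s, l = Letter.x := by
    intro l hl
    rcases l with _ | i | i
    · rfl
    · have h4 := congrArg (List.count (Letter.z i)) h2
      have h5 := List.count_pos_iff.2 hl
      have h6 := List.nodup_iff_count_le_one.1 hB.nodup i
      subst hZ
      simp at h4 h6
      omega
    · exact absurd hl (ht i)
  have h4 := congrArg (List.count Letter.x) h2
  have h5 : s.count Letter.x = s.length := List.count_eq_length.2 fun l hl => (hx l hl).symm
  simp at h4
  omega

/-- One occurrence is in the main block, the other on a side of the frame. Hence the image of `z_i`
is a repeated factor and `repeated_factor_sandwich` applies to it. -/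
theorem exists_two_occurrences (hB : BlockBalanced A B Z) (hZ : X₁ ++ Y ++ X₂ = Z) {i : ℕ}
    (hi : i ∈ Z) : ∃ a b c, sandwich A B X₁ Y X₂ =
      a ++ [Letter.z i] ++ b ++ [Letter.z i] ++ c := by
  have hc : Letter.z i ∈ zWord X₁ ++ Letter.x :: (zWord Y ++ Letter.x :: zWord X₂) := by
    subst hZ; simpa using hi
  obtain ⟨c₁, c₂, hc⟩ := List.append_of_mem hc
  rw [sandwich, hc]
  rcases hB.mem_iff.1 hi with h | h
  · obtain ⟨a, b, hab⟩ := List.append_of_mem (mem_ztWord.2 h)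
    exact ⟨a, b ++ c₁, c₂ ++ tzWord B, by simp [frame, hab]⟩
  · obtain ⟨a, b, hab⟩ := List.append_of_mem (mem_tzWord.2 h)
    exact ⟨ztWord A ++ c₁, c₂ ++ a, b, by simp [frame, hab]⟩

theorem append_cons_inj {α : Type*} [DecidableEq α] {l : α} {s s' r r' : List α} (hs : l ∉ s)
    (hs' : l ∉ s') (h : s ++ l :: r = s' ++ l :: r') : s = s' ∧ r = r' := by
  induction s generalizing s' with
  | nil =>
    rcases s' with _ | ⟨b, s'⟩
    · simpa using h
    · simp at h hs'; exact absurd h.1 hs'.1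
  | cons a s ih =>
    rcases s' with _ | ⟨b, s'⟩
    · simp at h hs; exact absurd h.1.symm hs.1
    · simp at h hs hs'
      obtain ⟨rfl, rfl⟩ := ih hs.2 hs'.2 h.2
      simp [h.1]

/-- A substitution that maps a sandwich word into another one over the same frame and does not
erase `x` fixes `x` and maps the three parts of the word into the corresponding parts. -/
structure RespectsBlocks (A B Z : List ℕ) (φ : Letter → List Letter) (p q : List Letter)
    (X₁ Y X₂ X₁' Y' X₂' : List ℕ) : Prop where
  map_x : φ Letter.x = [Letter.x]
  map_z : ∀ i ∈ Z, φ (Letter.z i) = [] ∨ ∃ j, φ (Letter.z i) = [Letter.z j]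
  left : p ++ ((ztWord A).flatMap φ ++ (zWord X₁).flatMap φ) = ztWord A ++ zWord X₁'
  middle : (zWord Y).flatMap φ = zWord Y'
  right : (zWord X₂).flatMap φ ++ ((tzWord B).flatMap φ ++ q) = zWord X₂' ++ tzWord B

/-- Images of repeated letters have length at most one and contain no linear letter. So the image of
`x Y x` begins and ends with the same letter, has length at least two and contains no linear letter;
it lies in the main block, where only `x` occurs twice. The remaining equations result from cutting
both words at the two `x`. -/
theorem respectsBlocks (hB : BlockBalanced A B Z) (hZ : X₁ ++ Y ++ X₂ = Z)
    (hZ' : X₁' ++ Y' ++ X₂' = Z) {φ : Letter → List Letter} {p q : List Letter}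
    (h : p ++ (sandwich A B X₁ Y X₂).flatMap φ ++ q = sandwich A B X₁' Y' X₂')
    (hx : φ Letter.x ≠ []) : RespectsBlocks A B Z φ p q X₁ Y X₂ X₁' Y' X₂' := by
  have hz : ∀ i ∈ Z, (∀ j, Letter.t j ∉ φ (Letter.z i)) ∧ (φ (Letter.z i)).length ≤ 1 := by
    intro i hi
    obtain ⟨a, b, c, habc⟩ := exists_two_occurrences hB hZ hi
    refine repeated_factor_sandwich hB hZ' (a := p ++ a.flatMap φ) (b := b.flatMap φ)
      (c := c.flatMap φ ++ q) ?_
    rw [← h, habc]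
    simp
  have hx1 : (∀ j, Letter.t j ∉ φ Letter.x) ∧ (φ Letter.x).length ≤ 1 := by
    refine repeated_factor_sandwich hB hZ'
      (a := p ++ (ztWord A ++ zWord X₁).flatMap φ) (b := (zWord Y).flatMap φ)
      (c := (zWord X₂ ++ tzWord B).flatMap φ ++ q) ?_
    rw [← h]
    simp [sandwich, frame]
  obtain ⟨l, hl⟩ : ∃ l, φ Letter.x = [l] := by
    rcases hφ : φ Letter.x with _ | ⟨l, _ | ⟨l', r⟩⟩
    · exact absurd hφ hx
    · exact ⟨l, rfl⟩
    · simp [hφ] at hx1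
  have ht : ∀ j, Letter.t j ∉ [l] ++ (zWord Y).flatMap φ ++ [l] := by
    intro j hj
    rw [← hl] at hj
    simp only [List.mem_append, List.mem_flatMap, zWord, List.mem_map] at hj
    rcases hj with (hj | ⟨_, ⟨i, hi, rfl⟩, hj⟩) | hj
    · exact hx1.1 j hj
    · exact (hz i (by subst hZ; simp [hi])).1 j hj
    · exact hx1.1 j hj
  obtain ⟨s₁, s₂, e1, e2, e3⟩ := localize (V₁ := p ++ (ztWord A ++ zWord X₁).flatMap φ)
    (V₂ := [l] ++ (zWord Y).flatMap φ ++ [l]) (V₃ := (zWord X₂ ++ tzWord B).flatMap φ ++ q)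
    (c := zWord X₁' ++ Letter.x :: (zWord Y' ++ Letter.x :: zWord X₂'))
    (by refine Eq.trans ?_ h; simp [sandwich, frame, hl]) ht (by simp)
  have hlx : l = Letter.x := by
    have h1 := congrArg (List.count l) e3
    rcases l with _ | i | i
    · rfl
    · have h6 := List.nodup_iff_count_le_one.1 hB.nodup i
      rw [← hZ'] at h6
      simp at h1 h6
      omega
    · exact absurd (by simp) (ht i)
  subst hlx
  have hcount := congrArg (List.count Letter.x) e3
  simp at hcount
  have hs1 : Letter.x ∉ s₁ := List.count_eq_zero.1 (by omega)
  have hs2 : Letter.x ∉ (zWord Y).flatMap φ := by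
    intro hmem
    have := List.count_pos_iff.2 hmem
    omega
  have hs3 : Letter.x ∉ s₂ := List.count_eq_zero.1 (by omega)
  have e4 : zWord X₁' ++ Letter.x :: (zWord Y' ++ Letter.x :: zWord X₂') =
      s₁ ++ Letter.x :: ((zWord Y).flatMap φ ++ Letter.x :: s₂) := by rw [e3]; simp
  obtain ⟨rfl, e5⟩ := append_cons_inj (by simp) hs1 e4
  obtain ⟨e6, rfl⟩ := append_cons_inj (by simp) hs2 e5
  rw [List.flatMap_append] at e1 e2
  refine ⟨hl, ?_, e1, e6.symm, by rw [← e2]; simp⟩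
  intro i hi
  -- Both occurrences of `x` in the target are already used by the images of `x`.
  have hxi : Letter.x ∉ φ (Letter.z i) := by
    intro hmem
    rw [← hZ, List.mem_append, List.mem_append] at hi
    rcases hi with (hi | hi) | hi
    · have : Letter.x ∈ ztWord A ++ zWord X₁' := by
        rw [← e1]
        simp only [List.mem_append, List.mem_flatMap]
        exact Or.inr (Or.inr ⟨_, mem_zWord.2 hi, hmem⟩)
      simp at this
    · exact hs2 (List.mem_flatMap.2 ⟨_, mem_zWord.2 hi, hmem⟩)
    · have : Letter.x ∈ zWord X₂' ++ tzWord B := by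
        rw [← e2]
        simp only [List.mem_append, List.mem_flatMap]
        exact Or.inl (Or.inl ⟨_, mem_zWord.2 hi, hmem⟩)
      simp at this
  obtain ⟨h1, h2⟩ := hz i hi
  rcases hφ : φ (Letter.z i) with _ | ⟨l, _ | ⟨l', r⟩⟩
  · exact Or.inl rfl
  · rcases l with _ | j | j
    · exact absurd (by simp [hφ]) hxi
    · exact Or.inr ⟨j, rfl⟩
    · exact absurd (by simp [hφ]) (h1 j)
  · simp [hφ] at h2

end sandwich

/-! ### Rigid beginnings and the left language -/

section closure

variable {A B Z X₁ Y X₂ X₁' Y' X₂' : List ℕ} {φ : Letter → List Letter} {p q : List Letter}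

theorem not_sublist_pair_swap {l : List ℕ} (hl : l.Nodup) {a b : ℕ} (h : [a, b].Sublist l)
    (h' : [b, a].Sublist l) : False := by
  have hpw : l.Pairwise (fun i j => l.idxOf i < l.idxOf j) := by
    rw [List.pairwise_iff_getElem]
    intro i j hi hj hij
    rwa [hl.idxOf_getElem, hl.idxOf_getElem]
  have h1 := hpw.sublist h
  have h2 := hpw.sublist h'
  simp at h1 h2
  omega

namespace RespectsBlocks

/-- Reversal exchanges the two sides of the frame; every statement about the left side gives one
about the right side. -/
theorem reverse (h : RespectsBlocks A B Z φ p q X₁ Y X₂ X₁' Y' X₂') :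
    RespectsBlocks B.reverse A.reverse Z.reverse (fun l => (φ l).reverse) q.reverse p.reverse
      X₂.reverse Y.reverse X₁.reverse X₂'.reverse Y'.reverse X₁'.reverse where
  map_x := by simp [h.map_x]
  map_z i hi := by
    rcases h.map_z i (List.mem_reverse.1 hi) with h1 | ⟨j, h1⟩
    · exact Or.inl (by simp [h1])
    · exact Or.inr ⟨j, by simp [h1]⟩
  left := by
    have := congrArg List.reverse h.right
    simpa [List.reverse_flatMap, Function.comp_def, reverse_zWord, reverse_tzWord] using this
  middle := by
    have := congrArg List.reverse h.middle
    simpa [List.reverse_flatMap, Function.comp_def, reverse_zWord] using this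
  right := by
    have := congrArg List.reverse h.left
    simpa [List.reverse_flatMap, Function.comp_def, reverse_zWord, reverse_ztWord] using this

theorem mem_middle (h : RespectsBlocks A B Z φ p q X₁ Y X₂ X₁' Y' X₂') {i i' : ℕ} (hi : i ∈ Y)
    (hφ : φ (Letter.z i) = [Letter.z i']) : i' ∈ Y' := by
  rw [← mem_zWord, ← h.middle]
  exact List.mem_flatMap.2 ⟨_, mem_zWord.2 hi, by simp [hφ]⟩

/-- The occurrence of `z_i` in the middle puts `i'` into `Y'`, so `i'` is not in `X₁'`. The
occurrence on the left side then has to land in `ztWord A`. -/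
theorem mem_left (h : RespectsBlocks A B Z φ p q X₁ Y X₂ X₁' Y' X₂') (hnd : Z.Nodup)
    (hZ' : X₁' ++ Y' ++ X₂' = Z) {i i' : ℕ} (hi : i ∈ Y)
    (hφ : φ (Letter.z i) = [Letter.z i']) (hA : i ∈ A) : i' ∈ A := by
  have h1 := h.mem_middle hi hφ
  have h2 : i' ∉ X₁' := fun h2 => by
    subst hZ'
    exact (List.disjoint_of_nodup_append (List.nodup_append.1 hnd).1) h2 h1
  have h3 : Letter.z i' ∈ ztWord A ++ zWord X₁' := by
    rw [← h.left]
    simp only [List.mem_append, List.mem_flatMap]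
    exact Or.inr (Or.inl ⟨_, mem_ztWord.2 hA, by simp [hφ]⟩)
  simpa [h2] using h3

theorem sublist_left (h : RespectsBlocks A B Z φ p q X₁ Y X₂ X₁' Y' X₂') (hnd : Z.Nodup)
    (hZ' : X₁' ++ Y' ++ X₂' = Z) {i i' j j' : ℕ} (hi : i ∈ Y) (hj : j ∈ Y)
    (hφ : φ (Letter.z i) = [Letter.z i']) (hφ' : φ (Letter.z j) = [Letter.z j'])
    (hA : [i, j].Sublist A) : [i', j'].Sublist A := by
  have hnot : ∀ {k}, k ∈ Y' → k ∉ X₁' := fun h1 h2 => by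
    subst hZ'
    exact (List.disjoint_of_nodup_append (List.nodup_append.1 hnd).1) h2 h1
  have h1 := hnot (h.mem_middle hi hφ)
  have h2 := hnot (h.mem_middle hj hφ')
  have h3 : [Letter.z i', Letter.z j'].Sublist (ztWord A ++ zWord X₁') := by
    rw [← h.left]
    refine List.Sublist.trans ?_ (List.sublist_append_right _ _)
    refine List.Sublist.trans ?_ (List.sublist_append_left _ _)
    have h4 : [Letter.z i, Letter.z j].Sublist (ztWord A) := by
      refine List.Sublist.trans ?_ (hA.flatMap _)
      simp
    refine List.Sublist.trans ?_ (h4.flatMap _)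
    simp [hφ, hφ']
  -- Reading off the indices of the `z` outside `X₁'` turns the left part of the target into a
  -- subsequence of `A` and keeps `i'` and `j'`.
  let g : Letter → Option ℕ := fun l => match l with
    | Letter.z k => if k ∈ X₁' then none else some k
    | _ => none
  have h5 := h3.filterMap g
  have h6 : (ztWord A).filterMap g = A.filter (· ∉ X₁') := by
    clear * -
    induction A with
    | nil => rfl
    | cons a A ih =>
      by_cases ha : a ∈ X₁' <;> simp [g, ha, ih]
  have h7 : (zWord X₁').filterMap g = [] := by
    rw [List.filterMap_eq_nil_iff]
    intro l hl
    obtain ⟨k, hk, rfl⟩ := List.mem_map.1 hl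
    simp [g, hk]
  rw [List.filterMap_append, h6, h7, List.append_nil] at h5
  have h8 : [Letter.z i', Letter.z j'].filterMap g = [i', j'] := by simp [g, h1, h2]
  rw [h8] at h5
  exact h5.trans List.filter_sublist

theorem mem_right (h : RespectsBlocks A B Z φ p q X₁ Y X₂ X₁' Y' X₂') (hnd : Z.Nodup)
    (hZ' : X₁' ++ Y' ++ X₂' = Z) {i i' : ℕ} (hi : i ∈ Y)
    (hφ : φ (Letter.z i) = [Letter.z i']) (hB : i ∈ B) : i' ∈ B := by
  have := h.reverse.mem_left (List.nodup_reverse.2 hnd) (by subst hZ'; simp) (i := i) (i' := i')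
    (by simpa using hi) (by simp [hφ]) (by simpa using hB)
  simpa using this

theorem sublist_right (h : RespectsBlocks A B Z φ p q X₁ Y X₂ X₁' Y' X₂') (hnd : Z.Nodup)
    (hZ' : X₁' ++ Y' ++ X₂' = Z) {i i' j j' : ℕ} (hi : i ∈ Y) (hj : j ∈ Y)
    (hφ : φ (Letter.z i) = [Letter.z i']) (hφ' : φ (Letter.z j) = [Letter.z j'])
    (hB : [i, j].Sublist B) : [i', j'].Sublist B := by
  have := h.reverse.sublist_left (List.nodup_reverse.2 hnd) (by subst hZ'; simp)
    (i := j) (i' := j') (j := i) (j' := i')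
    (by simpa using hj) (by simpa using hi) (by simp [hφ']) (by simp [hφ])
    (by simpa using hB.reverse)
  simpa using this.reverse

end RespectsBlocks

theorem length_flatMap_zWord_le {T : List ℕ}
    (h : ∀ i ∈ T, φ (Letter.z i) = [] ∨ ∃ j, φ (Letter.z i) = [Letter.z j]) :
    ((zWord T).flatMap φ).length ≤ T.length := by
  induction T with
  | nil => simp
  | cons a T ih =>
    have h1 := ih fun i hi => h i (List.mem_cons_of_mem _ hi)
    rcases h a List.mem_cons_self with h2 | ⟨j, h2⟩ <;> simp [h2, -List.length_flatMap] <;> omega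

/-- The pattern at the beginning of the main block that excludes shifts of the block: the letters
`a₀, a₂, a₁` come from one side of the frame, in the order `a₀, a₁, a₂` there, and the letters
between them come from the other side. -/
def IsRigidStart (A B : List ℕ) (a₀ d₁ a₂ d₂ a₁ : ℕ) : Prop :=
  ([a₀, a₁, a₂].Sublist A ∧ d₁ ∈ B ∧ d₂ ∈ B) ∨ ([a₀, a₁, a₂].Sublist B ∧ d₁ ∈ A ∧ d₂ ∈ A)

/-- The words that arise from the sandwich word with main block `x P Q x` by moving the first `x`
inside `P`. -/
def leftLanguage (A B P Q : List ℕ) : Set (List Letter) :=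
  {u | ∃ P₁ P₂, P₁ ++ P₂ = P ∧ u = sandwich A B P₁ (P₂ ++ Q) []}

/-- No letter has an image longer than one, so the block can at most shift to the right, the slack
being taken up by erased letters. The substitution preserves the side of the frame from which a
letter comes and the order of letters there; a shift by one violates the former, a shift by two
eventually one of the two. -/
theorem flatMap_fixes_of_isRigidStart {a₀ d₁ a₂ d₂ a₁ : ℕ} {T P₁ P₂ : List ℕ}
    (hB : BlockBalanced A B (a₀ :: d₁ :: a₂ :: d₂ :: a₁ :: T))
    (hr : IsRigidStart A B a₀ d₁ a₂ d₂ a₁) (hP : P₁ ++ P₂ = [a₀, d₁])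
    (h : RespectsBlocks A B (a₀ :: d₁ :: a₂ :: d₂ :: a₁ :: T) φ p q []
      (a₀ :: d₁ :: a₂ :: d₂ :: a₁ :: T) [] P₁ (P₂ ++ a₂ :: d₂ :: a₁ :: T) []) :
    (zWord (a₂ :: d₂ :: a₁ :: T)).flatMap φ = zWord (a₂ :: d₂ :: a₁ :: T) := by
  have hZ' : P₁ ++ (P₂ ++ a₂ :: d₂ :: a₁ :: T) ++ [] = a₀ :: d₁ :: a₂ :: d₂ :: a₁ :: T := by
    rw [← List.append_assoc, hP]; simp
  have hm := h.middle
  have hz := h.map_z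
  have hT : ((zWord T).flatMap φ).length ≤ T.length :=
    length_flatMap_zWord_le fun i hi => hz i (by simp [hi])
  have hI : ((zWord (a₂ :: d₂ :: a₁ :: T)).flatMap φ).length ≤ T.length + 3 :=
    length_flatMap_zWord_le fun i hi => hz i (by simp at hi ⊢; tauto)
  -- The image of the suffix is no longer than the suffix. Once the images of `a₀` and `d₁` are no
  -- longer than `P₂`, the lengths agree and both sides can be cut at the same place.
  suffices hlen : (φ (Letter.z a₀)).length + (φ (Letter.z d₁)).length ≤ P₂.length by
    have h1 : (φ (Letter.z a₀) ++ φ (Letter.z d₁)) ++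
        (zWord (a₂ :: d₂ :: a₁ :: T)).flatMap φ = zWord P₂ ++ zWord (a₂ :: d₂ :: a₁ :: T) := by
      simpa using hm
    have h2 := congrArg List.length h1
    simp only [List.length_append, length_zWord, List.length_cons] at h2
    exact (List.append_inj' h1 (by simp only [length_zWord, List.length_cons]; omega)).2
  have hl := fun {i i'} (hi : i ∈ a₀ :: d₁ :: a₂ :: d₂ :: a₁ :: T)
    (hφ : φ (Letter.z i) = [Letter.z i']) => h.mem_left hB.nodup hZ' hi hφ
  have hr' := fun {i i'} (hi : i ∈ a₀ :: d₁ :: a₂ :: d₂ :: a₁ :: T)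
    (hφ : φ (Letter.z i) = [Letter.z i']) => h.mem_right hB.nodup hZ' hi hφ
  have h01 : [a₀, a₁].Sublist [a₀, a₁, a₂] := by simp
  have h02 : [a₀, a₂].Sublist [a₀, a₁, a₂] := by simp
  have h12 : [a₁, a₂].Sublist [a₀, a₁, a₂] := by simp
  -- `c1`–`c4` hold because adjacent letters come from different sides of the frame.
  have c1 : φ (Letter.z a₀) ≠ [Letter.z d₁] := by
    intro hc
    rcases hr with ⟨h1, h2, h3⟩ | ⟨h1, h2, h3⟩
    · exact hB.not_mem_both (hl (by simp) hc (h1.subset (by simp))) h2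
    · exact hB.not_mem_both h2 (hr' (by simp) hc (h1.subset (by simp)))
  have c2 : φ (Letter.z d₁) ≠ [Letter.z a₂] := by
    intro hc
    rcases hr with ⟨h1, h2, h3⟩ | ⟨h1, h2, h3⟩
    · exact hB.not_mem_both (h1.subset (by simp)) (hr' (by simp) hc h2)
    · exact hB.not_mem_both (hl (by simp) hc h2) (h1.subset (by simp))
  have c3 : φ (Letter.z a₂) ≠ [Letter.z d₂] := by
    intro hc
    rcases hr with ⟨h1, h2, h3⟩ | ⟨h1, h2, h3⟩
    · exact hB.not_mem_both (hl (by simp) hc (h1.subset (by simp))) h3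
    · exact hB.not_mem_both h3 (hr' (by simp) hc (h1.subset (by simp)))
  have c4 : φ (Letter.z d₂) ≠ [Letter.z a₁] := by
    intro hc
    rcases hr with ⟨h1, h2, h3⟩ | ⟨h1, h2, h3⟩
    · exact hB.not_mem_both (h1.subset (by simp)) (hr' (by simp) hc h3)
    · exact hB.not_mem_both (hl (by simp) hc h3) (h1.subset (by simp))
  -- `c5` and `c6`: the frame has the order `a₀, a₁, a₂`, so neither the pair `a₀, a₂` nor the pair
  -- `a₀, a₁` can be sent to `a₂, a₁`.
  have c5 : φ (Letter.z a₀) = [Letter.z a₂] → φ (Letter.z a₂) ≠ [Letter.z a₁] := by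
    intro hc hc'
    rcases hr with ⟨h1, h2, h3⟩ | ⟨h1, h2, h3⟩
    · exact not_sublist_pair_swap hB.nodup_left (h12.trans h1)
        (h.sublist_left hB.nodup hZ' (by simp) (by simp) hc hc' (h02.trans h1))
    · exact not_sublist_pair_swap hB.nodup_right (h12.trans h1)
        (h.sublist_right hB.nodup hZ' (by simp) (by simp) hc hc' (h02.trans h1))
  have c6 : φ (Letter.z a₀) = [Letter.z a₂] → φ (Letter.z a₁) ≠ [Letter.z a₁] := by
    intro hc hc'
    rcases hr with ⟨h1, h2, h3⟩ | ⟨h1, h2, h3⟩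
    · exact not_sublist_pair_swap hB.nodup_left (h12.trans h1)
        (h.sublist_left hB.nodup hZ' (by simp) (by simp) hc hc' (h01.trans h1))
    · exact not_sublist_pair_swap hB.nodup_right (h12.trans h1)
        (h.sublist_right hB.nodup hZ' (by simp) (by simp) hc hc' (h01.trans h1))
  simp only [zWord_cons, zWord_append, List.flatMap_cons] at hm
  have g0 := hz a₀ (by simp)
  have g1 := hz d₁ (by simp)
  have g2 := hz a₂ (by simp)
  have g3 := hz d₂ (by simp)
  have g4 := hz a₁ (by simp)
  clear hl hr' hr hB h hz hI
  generalize (zWord T).flatMap φ = W at hm hT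
  -- If `P₁` has one letter, `c1` suffices. If it has two, both `a₀` and `d₁` must be erased:
  -- otherwise `c2` forces `a₀ ↦ a₂`, and `c3`–`c6` together with the bound on the image of `T`
  -- leave no way to produce `d₂ a₁ T`.
  rcases P₁ with _ | ⟨b₀, _ | ⟨b₁, _ | _⟩⟩
  · simp only [List.nil_append] at hP
    subst hP
    rcases g0 with g0 | ⟨i, g0⟩ <;> rcases g1 with g1 | ⟨j, g1⟩ <;> simp [g0, g1]
  · simp only [List.cons_append, List.nil_append, List.cons.injEq] at hP
    obtain ⟨rfl, rfl⟩ := hP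
    rcases g0 with g0 | ⟨i, g0⟩ <;> rcases g1 with g1 | ⟨j, g1⟩ <;> simp [g0, g1]
    simp [g0] at hm
    exact c1 (by rw [g0, hm.1])
  · have hP2 : P₂ = [] := by simpa using (List.cons.inj (List.cons.inj hP).2).2
    subst hP2
    simp only [zWord_nil, List.nil_append] at hm
    rcases g0 with g0 | ⟨i, g0⟩
    · rcases g1 with g1 | ⟨j, g1⟩
      · simp [g0, g1]
      · simp [g0, g1] at hm
        exact absurd (by rw [g1, hm.1]) c2
    · exfalso
      simp only [g0, List.cons_append, List.nil_append, List.cons.injEq, Letter.z.injEq] at hm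
      obtain ⟨rfl, hm⟩ := hm
      have c6' := c6 g0
      have c5' := c5 g0
      rcases g1 with g1 | ⟨j, g1⟩
      · rcases g2 with g2 | ⟨k, g2⟩
        · have hlen := congrArg List.length hm
          rcases g3 with g3 | ⟨l, g3⟩ <;> rcases g4 with g4 | ⟨m, g4⟩ <;>
            simp [g1, g2, g3, g4] at hm hlen
          · simp [hlen] at hT
          · omega
          · omega
          · exact c6' (by rw [g4, hm.2.1])
        · simp [g1, g2] at hm
          exact c3 (by rw [g2, hm.1])
      · simp [g1] at hm
        obtain ⟨-, hm⟩ := hm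
        rcases g2 with g2 | ⟨k, g2⟩
        · rcases g3 with g3 | ⟨l, g3⟩
          · have hlen := congrArg List.length hm
            rcases g4 with g4 | ⟨m, g4⟩ <;> simp [g2, g3, g4] at hm hlen
            · omega
            · exact c6' (by rw [g4, hm.1])
          · simp [g2, g3] at hm
            exact c4 (by rw [g3, hm.1])
        · simp [g2] at hm
          exact c5' (by rw [g2, hm.1])
  · simp at hP

/-- Moving the first `x` over the first two letters of a rigid main block is compatible with all
substitutions, relative to the left language. -/
theorem leftLanguage_substitution {a₀ d₁ a₂ d₂ a₁ : ℕ} {T : List ℕ}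
    (hB : BlockBalanced A B (a₀ :: d₁ :: a₂ :: d₂ :: a₁ :: T))
    (hr : IsRigidStart A B a₀ d₁ a₂ d₂ a₁) (φ : Letter → List Letter) (p q : List Letter) :
    p ++ (sandwich A B [] (a₀ :: d₁ :: a₂ :: d₂ :: a₁ :: T) []).flatMap φ ++ q ∈
        leftLanguage A B [a₀, d₁] (a₂ :: d₂ :: a₁ :: T) ↔
      p ++ (sandwich A B [a₀, d₁] (a₂ :: d₂ :: a₁ :: T) []).flatMap φ ++ q ∈
        leftLanguage A B [a₀, d₁] (a₂ :: d₂ :: a₁ :: T) := by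
  -- If `x` is erased, both words have the same image, as they differ only in the position of `x`.
  by_cases hx : φ Letter.x = []
  · have : (sandwich A B [] (a₀ :: d₁ :: a₂ :: d₂ :: a₁ :: T) []).flatMap φ =
        (sandwich A B [a₀, d₁] (a₂ :: d₂ :: a₁ :: T) []).flatMap φ := by
      simp [sandwich, frame, hx]
    rw [this]
  constructor
  · rintro ⟨P₁, P₂, hP, h⟩
    have hZ' : P₁ ++ (P₂ ++ a₂ :: d₂ :: a₁ :: T) ++ [] = a₀ :: d₁ :: a₂ :: d₂ :: a₁ :: T := by
      rw [← List.append_assoc, hP]; simp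
    have hR := respectsBlocks hB (by simp) hZ' h hx
    have hI := flatMap_fixes_of_isRigidStart hB hr hP hR
    have hPm : (zWord [a₀, d₁]).flatMap φ = zWord P₂ := by
      have h1 : (zWord [a₀, d₁]).flatMap φ ++ (zWord (a₂ :: d₂ :: a₁ :: T)).flatMap φ =
          zWord P₂ ++ zWord (a₂ :: d₂ :: a₁ :: T) := by
        have := hR.middle
        simpa using this
      rw [hI] at h1
      exact List.append_cancel_right h1
    refine ⟨[a₀, d₁], [], by simp, ?_⟩
    have hl := hR.left
    have hrr := hR.right
    simp only [zWord_nil, List.flatMap_nil, List.nil_append, List.append_nil] at hl hrr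
    calc p ++ (sandwich A B [a₀, d₁] (a₂ :: d₂ :: a₁ :: T) []).flatMap φ ++ q
        = (p ++ (ztWord A).flatMap φ) ++ (zWord [a₀, d₁]).flatMap φ ++ (φ Letter.x ++
          (zWord (a₂ :: d₂ :: a₁ :: T)).flatMap φ ++ φ Letter.x ++
            ((tzWord B).flatMap φ ++ q)) := by simp [sandwich, frame]
      _ = _ := by
        rw [hl, hPm, hI, hR.map_x, hrr, List.append_assoc (ztWord A), ← zWord_append, hP]
        simp [sandwich, frame]
  · rintro ⟨P₁, P₂, hP, h⟩
    have hZ' : P₁ ++ (P₂ ++ a₂ :: d₂ :: a₁ :: T) ++ [] = a₀ :: d₁ :: a₂ :: d₂ :: a₁ :: T := by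
      rw [← List.append_assoc, hP]; simp
    have hR := respectsBlocks hB (by simp) hZ' h hx
    have hm := hR.middle
    have hlen := length_flatMap_zWord_le (φ := φ) (T := a₂ :: d₂ :: a₁ :: T)
      fun i hi => hR.map_z i (by simp at hi ⊢; tauto)
    rw [hm] at hlen
    -- The main block of the source is too short to cover any letter of `P₂`.
    have hP2 : P₂ = [] := by
      rw [← List.length_eq_zero_iff]
      simp only [length_zWord, List.length_append] at hlen
      omega
    subst hP2
    rw [List.append_nil] at hP
    subst hP
    rw [List.nil_append] at hm
    have hlP := length_flatMap_zWord_le (φ := φ) (T := [a₀, d₁])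
      fun i hi => hR.map_z i (by simp at hi ⊢; tauto)
    have hl := hR.left
    have hrr := hR.right
    simp only [zWord_nil, List.flatMap_nil, List.nil_append] at hrr
    -- The image of `z_{a₀} z_{d₁}` has length at most two and ends right before `x`, so it is a
    -- suffix of the two letters there; this suffix becomes the new `P₂`.
    obtain ⟨P₁, P₂, hP, h1, h2⟩ : ∃ P₁ P₂, P₁ ++ P₂ = [a₀, d₁] ∧
        p ++ (ztWord A).flatMap φ = ztWord A ++ zWord P₁ ∧
        (zWord [a₀, d₁]).flatMap φ = zWord P₂ := by
      rw [← List.append_assoc] at hl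
      generalize p ++ (ztWord A).flatMap φ = W at hl
      generalize (zWord [a₀, d₁]).flatMap φ = W' at hl hlP
      rcases W' with _ | ⟨l, _ | ⟨l', _ | _⟩⟩
      · exact ⟨[a₀, d₁], [], by simp, by simpa using hl, rfl⟩
      · have h3 : W ++ [l] = (ztWord A ++ [Letter.z a₀]) ++ [Letter.z d₁] := by simpa using hl
        obtain ⟨h4, h5⟩ := List.append_inj' h3 rfl
        exact ⟨[a₀], [d₁], by simp, h4, h5⟩
      · obtain ⟨h4, h5⟩ := List.append_inj' hl rfl
        exact ⟨[], [a₀, d₁], by simp, by simpa using h4, h5⟩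
      · simp at hlP
    refine ⟨P₁, P₂, hP, ?_⟩
    calc p ++ (sandwich A B [] (a₀ :: d₁ :: a₂ :: d₂ :: a₁ :: T) []).flatMap φ ++ q
        = (p ++ (ztWord A).flatMap φ) ++ (φ Letter.x ++ ((zWord [a₀, d₁]).flatMap φ ++
          (zWord (a₂ :: d₂ :: a₁ :: T)).flatMap φ) ++ φ Letter.x ++
            ((tzWord B).flatMap φ ++ q)) := by simp [sandwich, frame]
      _ = _ := by
        rw [h1, h2, hm, hR.map_x, hrr]
        simp [sandwich, frame]

/-- A sandwich word with a shorter main block is identified by the factor monoid of the full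
sandwich word with any word in which `x` occurs as a square. -/
theorem isIdentityOf_of_shorter (hB : BlockBalanced A B Z) (hZ : X₁ ++ Y ++ X₂ = Z)
    (hY : Y.length < Z.length) :
    IsIdentityOf (sandwich A B [] Z []) (sandwich A B X₁ Y X₂)
      (Letter.x :: Letter.x :: frame A B (zWord Z)) := by
  intro φ hφ
  by_cases hx : φ Letter.x = []
  · subst hZ
    simp [sandwich, frame, hx]
  exfalso
  -- With `x` kept, the first word fails because `Y` is too short to cover the main block `Z`. The
  -- second would produce a square of a letter, but the two `x` of the target are separated by `Z`
  -- and its main block contains every `z` at most once.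
  rcases hφ with ⟨p, q, h⟩ | ⟨p, q, h⟩
  · have hR := respectsBlocks hB hZ (by simp) h hx
    have hlen := length_flatMap_zWord_le (φ := φ) (T := Y)
      fun i hi => hR.map_z i (by subst hZ; simp [hi])
    rw [hR.middle] at hlen
    simp at hlen
    omega
  · have h1 := repeated_factor_sandwich (X₁ := []) (Y := Z) (X₂ := []) (a := p) (b := [])
      (s := φ Letter.x) (c := (frame A B (zWord Z)).flatMap φ ++ q) hB (by simp)
      (by rw [← h]; simp)
    obtain ⟨l, hl⟩ : ∃ l, φ Letter.x = [l] := by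
      rcases hφ : φ Letter.x with _ | ⟨l, _ | ⟨l', r⟩⟩
      · exact absurd hφ hx
      · exact ⟨l, rfl⟩
      · simp [hφ] at h1
    obtain ⟨s₁, s₂, -, -, e3⟩ := localize (V₁ := p) (V₂ := [l, l])
      (V₃ := (frame A B (zWord Z)).flatMap φ ++ q)
      (c := zWord [] ++ Letter.x :: (zWord Z ++ Letter.x :: zWord []))
      (by refine Eq.trans ?_ h; simp [hl]) (by rw [hl] at h1; simpa using h1.1) (by simp)
    have h2 := congrArg (List.count l) e3
    rcases l with _ | i | i
    · simp at h2
      have hs1 : Letter.x ∉ s₁ := List.count_eq_zero.1 (by omega)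
      have e4 : s₁ ++ Letter.x :: (Letter.x :: s₂) =
        [] ++ Letter.x :: (zWord Z ++ Letter.x :: []) := by simpa using e3.symm
      obtain ⟨rfl, e5⟩ := append_cons_inj hs1 (by simp) e4
      rcases Z with _ | ⟨i, Z⟩
      · simp at hY
      · simp at e5
    · have h6 := List.nodup_iff_count_le_one.1 hB.nodup i
      simp at h2
      omega
    · simp at h2
end closure

/-! ### Restrictions of words to sets of letters -/

/-- The restriction of a word to a set of letters. -/
noncomputable def restrict (S : List Letter) (u : List Letter) : List Letter :=
  u.filter (· ∈ S)

section restrict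

variable {S T u v : List Letter} {a b l : Letter} {φ : Letter → List Letter}

@[simp] theorem restrict_nil : restrict S [] = [] := rfl

theorem restrict_cons_of_mem (h : a ∈ S) : restrict S (a :: u) = a :: restrict S u := by
  simp [restrict, h]

theorem restrict_cons_of_notMem (h : a ∉ S) : restrict S (a :: u) = restrict S u := by
  simp [restrict, h]

@[simp] theorem restrict_append : restrict S (u ++ v) = restrict S u ++ restrict S v :=
  List.filter_append _ _

@[simp] theorem mem_restrict : l ∈ restrict S u ↔ l ∈ u ∧ l ∈ S := by simp [restrict]

theorem restrict_restrict (h : T ⊆ S) : restrict T (restrict S u) = restrict T u := by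
  rw [restrict, restrict, restrict, List.filter_filter]
  refine List.filter_congr fun l _ => ?_
  by_cases hl : l ∈ T
  · simp [hl, h hl]
  · simp [hl]

theorem restrict_congr (h : ∀ l, l ∈ S ↔ l ∈ T) : restrict S u = restrict T u := by
  simp [restrict, h]

theorem restrict_swap : restrict [a, b] u = restrict [b, a] u :=
  restrict_congr fun l => by simp [or_comm]

theorem restrict_eq_of_subset (h : T ⊆ S) (huv : restrict S u = restrict S v) :
    restrict T u = restrict T v := by
  rw [← restrict_restrict h, huv, restrict_restrict h]

theorem restrict_eq_nil (h : ∀ l ∈ u, l ∉ S) : restrict S u = [] := by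
  rw [restrict, List.filter_eq_nil_iff]
  simpa using h

theorem count_restrict (h : l ∈ S) : (restrict S u).count l = u.count l :=
  List.count_filter (by simpa using h)

theorem flatMap_restrict (h : ∀ l, l ∉ S → φ l = []) : (restrict S u).flatMap φ = u.flatMap φ := by
  induction u with
  | nil => rfl
  | cons a u ih =>
    by_cases ha : a ∈ S
    · rw [restrict_cons_of_mem ha]; simp [ih]
    · rw [restrict_cons_of_notMem ha]; simp [ih, h a ha]

theorem length_restrict_cons (h : a ∉ S) :
    (restrict (a :: S) u).length = u.count a + (restrict S u).length := by
  induction u with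
  | nil => rfl
  | cons b u ih =>
    by_cases hb : b = a
    · subst hb
      rw [restrict_cons_of_mem (by simp), restrict_cons_of_notMem h]
      simp [ih]; omega
    · by_cases hb' : b ∈ S
      · rw [restrict_cons_of_mem (by simp [hb']), restrict_cons_of_mem hb']
        simp [ih, hb]; omega
      · rw [restrict_cons_of_notMem (by simp [hb', hb]), restrict_cons_of_notMem hb']
        simp [ih, hb]

@[simp] theorem restrict_empty : restrict [] u = [] := by simp [restrict]

/-- Used to compute a restriction from a subsequence and the numbers of occurrences of the letters,
which bound its length. -/
theorem restrict_eq_of_sublist {s : List Letter} (h : s.Sublist u) (hs : ∀ l ∈ s, l ∈ S)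
    (hl : (restrict S u).length ≤ s.length) : restrict S u = s := by
  have h1 : (restrict S s).Sublist (restrict S u) := h.filter _
  have h2 : restrict S s = s := by
    rw [restrict, List.filter_eq_self]
    simpa using hs
  rw [h2] at h1
  exact (h1.eq_of_length_le hl).symm

/-- A word is determined by the numbers of occurrences of its letters and its restrictions to the
pairs of consecutive letters. -/
theorem eq_of_restrict_consecutive {u v : List Letter} (hc : ∀ l, v.count l = u.count l)
    (hp : u.IsChain fun a b => restrict [a, b] v = restrict [a, b] u) : v = u := by
  induction u generalizing v with
  | nil =>
    rw [List.eq_nil_iff_forall_not_mem]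
    intro l hl
    have := List.count_pos_iff.2 hl
    simp [hc] at this
  | cons y u ih =>
    have hhead : ∃ v', v = y :: v' := by
      rcases v with _ | ⟨c, v⟩
      · have := hc y; simp at this
      by_contra hne
      have hcy : c ≠ y := fun h => hne ⟨v, by rw [h]⟩
      have hcu : c ∈ u := by
        have h1 : c ∈ y :: u := by rw [← List.count_pos_iff, ← hc]; simp
        simpa [hcy] using h1
      -- If `v` starts with `c ≠ y`, take the letter right before the first `c` in `y :: u`.
      -- Restricted to these two letters, `v` starts with `c`, but `y :: u` does not.
      obtain ⟨s₁, s₂, hs12, hfirst⟩ := List.eq_append_cons_of_mem hcu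
      rcases List.eq_nil_or_concat s₁ with rfl | ⟨s₃, e, rfl⟩
      · rw [hs12, List.nil_append] at hp
        have h1 := (List.isChain_cons_cons.1 hp).1
        rw [restrict_cons_of_mem (by simp), restrict_cons_of_mem (by simp)] at h1
        exact hcy (List.cons.inj h1).1
      · have hp' : ((y :: s₃) ++ e :: c :: s₂).IsChain
            fun a b => restrict [a, b] (c :: v) = restrict [a, b] (y :: u) := by
          have : y :: u = (y :: s₃) ++ e :: c :: s₂ := by simp [hs12]
          rwa [← this]
        have h1 := (List.isChain_cons_cons.1 (List.isChain_append.1 hp').2.1).1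
        have h2 : y :: u = ((y :: s₃) ++ [e]) ++ c :: s₂ := by simp [hs12]
        rw [h2, restrict_cons_of_mem (by simp), restrict_append, restrict_append] at h1
        have h3 : c ∉ restrict [e, c] (y :: s₃) ++ restrict [e, c] [e] := by
          simp only [List.concat_eq_append, List.mem_append, List.mem_singleton, not_or] at hfirst
          simp [restrict, hcy, hfirst.1, hfirst.2]
        rw [restrict_cons_of_mem (a := e) (by simp)] at h1 h3
        generalize restrict [e, c] (y :: s₃) = W at h1 h3
        rcases W with _ | ⟨w, W⟩
        · simp at h1 h3; exact h3 h1.1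
        · simp at h1 h3; exact h3.1 h1.1
    obtain ⟨v, rfl⟩ := hhead
    congr 1
    refine ih (fun l => ?_) ?_
    · have := hc l
      simpa [List.count_cons] using this
    · refine List.IsChain.imp ?_ hp.tail
      intro a b hab
      by_cases hy : y ∈ [a, b]
      · rw [restrict_cons_of_mem hy, restrict_cons_of_mem hy] at hab
        exact (List.cons.inj hab).2
      · rwa [restrict_cons_of_notMem hy, restrict_cons_of_notMem hy] at hab

end restrict

/-! ### Rigidity of the word without `x` -/

/-- The factors of `w` that allow its factor monoid to recognise the order of letters. -/
structure HasPatterns (w : List Letter) : Prop where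
  enclosed : ∃ (y : Letter) (b : List Letter), y ∉ b ∧ b ≠ [] ∧ [y] ++ b ++ [y] <:+: w
  before : ∃ (c y : Letter) (b : List Letter), c ≠ y ∧ [c, y] ++ b ++ [y] <:+: w
  after : ∃ (c y : Letter) (b : List Letter), c ≠ y ∧ [y] ++ b ++ [y, c] <:+: w
  crossing : ∃ (y y' : Letter) (a b : List Letter),
    y ≠ y' ∧ [y] ++ a ++ [y', y] ++ b ++ [y'] <:+: w

theorem IsIdentityOf.symm {w u v : List Letter} (h : IsIdentityOf w u v) : IsIdentityOf w v u :=
  fun φ hφ => (h φ hφ.symm).symm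

theorem IsIdentityOf.filter_ne {w u v : List Letter} (h : IsIdentityOf w u v) (l : Letter) :
    IsIdentityOf w (u.filter (· ≠ l)) (v.filter (· ≠ l)) := by
  intro φ hφ
  have key : ∀ r : List Letter,
      (r.filter (· ≠ l)).flatMap φ = r.flatMap (fun a => if a = l then [] else φ a) := by
    intro r
    induction r with
    | nil => rfl
    | cons a r ih => by_cases ha : a = l <;> simp_all
  rw [key, key] at *
  exact h _ hφ

/-- Map a letter missing from `u` to a letter of `w` and erase all others: the image of `u` is the
empty factor, so the image of `v` must be empty as well. -/
theorem IsIdentityOf.subset {w u v : List Letter} (h : IsIdentityOf w u v) (hw : w ≠ []) :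
    v ⊆ u := by
  intro l hl
  by_contra hlu
  obtain ⟨c, w, rfl⟩ := List.exists_cons_of_ne_nil hw
  have h1 := h (fun a => if a = l then [c] else []) (Or.inl ?_)
  · have h2 : u.flatMap (fun a => if a = l then [c] else []) = [] := by
      rw [List.flatMap_eq_nil_iff]
      intro a ha
      rw [if_neg]
      rintro rfl
      exact hlu ha
    rw [h2, eq_comm, List.flatMap_eq_nil_iff] at h1
    simpa using h1 l hl
  · have h2 : u.flatMap (fun a => if a = l then [c] else []) = [] := by
      rw [List.flatMap_eq_nil_iff]
      intro a ha
      rw [if_neg]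
      rintro rfl
      exact hlu ha
    rw [h2]
    exact List.nil_infix

/-- A word over two letters whose image under `a ↦ y`, `b ↦ s` is `y s y` equals `a b a`. -/
theorem eq_of_flatMap_enclosed {a b y : Letter} {s r : List Letter} {φ : Letter → List Letter}
    (ha : φ a = [y]) (hb : φ b = s) (hy : y ∉ s) (hs : s ≠ []) (hr : ∀ l ∈ r, l = a ∨ l = b)
    (h : r.flatMap φ = [y] ++ s ++ [y]) : r = [a, b, a] := by
  obtain ⟨c, s, rfl⟩ := List.exists_cons_of_ne_nil hs
  simp only [List.mem_cons, not_or] at hy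
  rcases r with _ | ⟨l, r⟩
  · simp at h
  rcases hr l (by simp) with rfl | rfl
  swap
  · simp [hb] at h; exact absurd h.1.symm hy.1
  simp only [List.flatMap_cons, ha, List.cons_append, List.nil_append, List.cons.injEq,
    true_and] at h
  rcases r with _ | ⟨l', r⟩
  · simp at h
  rcases hr l' (by simp) with rfl | rfl
  · simp [ha] at h; exact absurd h.1 hy.1
  simp only [List.flatMap_cons, hb, List.cons_append, List.cons.injEq, true_and,
    List.append_cancel_left_eq] at h
  rcases r with _ | ⟨l'', r⟩
  · simp at h
  rcases hr l'' (by simp) with rfl | rfl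
  swap
  · simp [hb] at h; exact absurd h.1.symm hy.1
  simp only [List.flatMap_cons, ha, List.cons_append, List.nil_append, List.cons.injEq,
    true_and] at h
  rcases r with _ | ⟨l₃, r⟩
  · rfl
  rcases hr l₃ (by simp) with rfl | rfl <;> simp [ha, hb] at h

section skeleton

variable {w : List Letter} {A B Z : List ℕ}

theorem filter_ne_x_sandwich {X₁ Y X₂ : List ℕ} (hZ : X₁ ++ Y ++ X₂ = Z) :
    (sandwich A B X₁ Y X₂).filter (· ≠ Letter.x) = frame A B (zWord Z) := by
  have key : ∀ l : List Letter, Letter.x ∉ l → l.filter (· ≠ Letter.x) = l := by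
    intro l hl
    rw [List.filter_eq_self]
    intro a ha
    simpa using fun h' : a = Letter.x => hl (h' ▸ ha)
  subst hZ
  simp only [sandwich, frame, List.filter_append, List.filter_cons]
  rw [key _ x_notMem_ztWord, key _ x_notMem_tzWord, key _ x_notMem_zWord, key _ x_notMem_zWord,
    key _ x_notMem_zWord]
  simp

theorem count_z_frame (hB : BlockBalanced A B Z) {i : ℕ} (hi : i ∈ Z) :
    (frame A B (zWord Z)).count (Letter.z i) = 2 := by
  have h1 := hB.count_add hi
  have h2 := List.count_eq_one_of_mem hB.nodup hi
  simp [frame, h2]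
  omega

theorem count_t_frame (hB : BlockBalanced A B Z) {i : ℕ} (hi : i ∈ Z) :
    (frame A B (zWord Z)).count (Letter.t i) = 1 := by
  have h1 := hB.count_add hi
  simp [frame]
  omega

theorem exists_sublist_pair {l : List ℕ} {i j : ℕ} (hi : i ∈ l) (hj : j ∈ l) (hij : i ≠ j) :
    [i, j].Sublist l ∨ [j, i].Sublist l := by
  obtain ⟨s, r, rfl⟩ := List.append_of_mem hi
  simp only [List.mem_append, List.mem_cons] at hj
  rcases hj with hj | rfl | hj
  · right
    exact (List.singleton_sublist.2 hj).append (List.singleton_sublist.2 List.mem_cons_self)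
  · exact absurd rfl hij
  · left
    exact ((List.singleton_sublist.2 hj).cons_cons i).trans (List.sublist_append_right _ _)

/-- The three possible positions of a linear letter relative to a letter of the main block. -/
theorem frame_sublist_cases (hB : BlockBalanced A B Z) {i j : ℕ} (hi : i ∈ Z) (hj : j ∈ Z) :
    [Letter.z i, Letter.t j, Letter.z i].Sublist (frame A B (zWord Z)) ∨
    (i ≠ j ∧ [Letter.t j, Letter.z i, Letter.t i, Letter.z i].Sublist (frame A B (zWord Z))) ∨
    (i ≠ j ∧ [Letter.z i, Letter.t i, Letter.z i, Letter.t j].Sublist (frame A B (zWord Z))) := by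
  have hz : [Letter.z i].Sublist (zWord Z) := by simpa using hi
  have hzA : ∀ {k}, k ∈ A → [Letter.z k, Letter.t k].Sublist (ztWord A) := by
    intro k hk
    simpa [ztWord] using (List.singleton_sublist.2 hk).flatMap fun i => [Letter.z i, Letter.t i]
  have hzB : ∀ {k}, k ∈ B → [Letter.t k, Letter.z k].Sublist (tzWord B) := by
    intro k hk
    simpa [tzWord] using (List.singleton_sublist.2 hk).flatMap fun i => [Letter.t i, Letter.z i]
  have hnil : ([] : List Letter).Sublist (tzWord B) := List.nil_sublist _
  have hnil' : ([] : List Letter).Sublist (ztWord A) := List.nil_sublist _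
  rcases hB.mem_iff.1 hi with hiA | hiB
  · by_cases hij : i = j
    · subst hij
      exact Or.inl (by simpa [frame] using ((hzA hiA).append hz).append hnil)
    rcases hB.mem_iff.1 hj with hjA | hjB
    · rcases exists_sublist_pair hiA hjA hij with h | h
      · have h1 : [Letter.z i, Letter.t j].Sublist (ztWord A) := by
          refine List.Sublist.trans ?_ (h.flatMap fun i => [Letter.z i, Letter.t i])
          simp
        exact Or.inl (by simpa [frame] using (h1.append hz).append hnil)
      · have h1 : [Letter.t j, Letter.z i, Letter.t i].Sublist (ztWord A) := by
          refine List.Sublist.trans ?_ (h.flatMap fun i => [Letter.z i, Letter.t i])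
          simp
        exact Or.inr (Or.inl ⟨hij, by simpa [frame] using (h1.append hz).append hnil⟩)
    · have h1 : [Letter.t j].Sublist (tzWord B) := by simpa using hjB
      exact Or.inr (Or.inr ⟨hij, by simpa [frame] using ((hzA hiA).append hz).append h1⟩)
  · by_cases hij : i = j
    · subst hij
      exact Or.inl (by simpa [frame] using (hnil'.append hz).append (hzB hiB))
    rcases hB.mem_iff.1 hj with hjA | hjB
    · have h1 : [Letter.t j].Sublist (ztWord A) := by simpa using hjA
      exact Or.inr (Or.inl ⟨hij, by simpa [frame] using (h1.append hz).append (hzB hiB)⟩)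
    · rcases exists_sublist_pair hiB hjB hij with h | h
      · have h1 : [Letter.t i, Letter.z i, Letter.t j].Sublist (tzWord B) := by
          refine List.Sublist.trans ?_ (h.flatMap fun i => [Letter.t i, Letter.z i])
          simp
        exact Or.inr (Or.inr ⟨hij, by simpa [frame] using (hnil'.append hz).append h1⟩)
      · have h1 : [Letter.t j, Letter.z i].Sublist (tzWord B) := by
          refine List.Sublist.trans ?_ (h.flatMap fun i => [Letter.t i, Letter.z i])
          simp
        exact Or.inl (by simpa [frame] using (hnil'.append hz).append h1)

/-- In any word that the factor monoid identifies with `u`, a letter that separates two occurrences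
of another letter in `u` does so, too. -/
theorem restrict_eq_of_enclosed (hw : HasPatterns w) {u v : List Letter}
    (h : IsIdentityOf w u v) {a b : Letter} (hab : a ≠ b) (hu : restrict [a, b] u = [a, b, a]) :
    restrict [a, b] v = [a, b, a] := by
  obtain ⟨y, s, hy, hs, hf⟩ := hw.enclosed
  let φ : Letter → List Letter := fun l => if l = a then [y] else if l = b then s else []
  have ha : φ a = [y] := by simp [φ]
  have hb : φ b = s := by simp [φ, hab.symm]
  have hφ : ∀ l, l ∉ [a, b] → φ l = [] := by
    intro l hl
    simp only [List.mem_cons, List.not_mem_nil, or_false, not_or] at hl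
    simp [φ, hl.1, hl.2]
  have hu' : u.flatMap φ = [y] ++ s ++ [y] := by
    rw [← flatMap_restrict hφ, hu]; simp [ha, hb]
  have hv : v.flatMap φ = [y] ++ s ++ [y] := by rw [← hu', h φ (Or.inl (hu' ▸ hf))]
  rw [← flatMap_restrict hφ] at hv
  exact eq_of_flatMap_enclosed ha hb hy hs (by simp) hv

variable {v : List Letter}

theorem restrict_zt_self (hw : HasPatterns w) (hB : BlockBalanced A B Z)
    (h : IsIdentityOf w (frame A B (zWord Z)) v) {i : ℕ} (hi : i ∈ Z) :
    restrict [Letter.z i, Letter.t i] v = [Letter.z i, Letter.t i, Letter.z i] := by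
  refine restrict_eq_of_enclosed hw h (by simp) ?_
  rcases frame_sublist_cases hB hi hi with h1 | ⟨h1, -⟩ | ⟨h1, -⟩
  · refine restrict_eq_of_sublist h1 (by simp) ?_
    rw [length_restrict_cons (by simp), length_restrict_cons (by simp), count_z_frame hB hi,
      count_t_frame hB hi]
    simp
  · exact absurd rfl h1
  · exact absurd rfl h1

theorem count_z_eq (hw : HasPatterns w) (hB : BlockBalanced A B Z)
    (h : IsIdentityOf w (frame A B (zWord Z)) v) {i : ℕ} (hi : i ∈ Z) :
    v.count (Letter.z i) = 2 := by
  rw [← count_restrict (S := [Letter.z i, Letter.t i]) (by simp), restrict_zt_self hw hB h hi]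
  simp

theorem count_t_eq (hw : HasPatterns w) (hB : BlockBalanced A B Z)
    (h : IsIdentityOf w (frame A B (zWord Z)) v) {i : ℕ} (hi : i ∈ Z) :
    v.count (Letter.t i) = 1 := by
  rw [← count_restrict (S := [Letter.z i, Letter.t i]) (by simp), restrict_zt_self hw hB h hi]
  simp

/-- If `t_j` separates the two `z_i`, the pattern `enclosed` applies. If `t_j` precedes or follows
both, then `t_i` is added to the restriction, and the pattern `before` or `after` is its image. As
the order of `z_i` and `t_i` is already known, only the place of `t_j` is open; the end letter of
the pattern, being different from `y`, forces it to that end. -/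
theorem restrict_zt (hw : HasPatterns w) (hB : BlockBalanced A B Z)
    (h : IsIdentityOf w (frame A B (zWord Z)) v) {i j : ℕ} (hi : i ∈ Z) (hj : j ∈ Z) :
    restrict [Letter.z i, Letter.t j] v =
      restrict [Letter.z i, Letter.t j] (frame A B (zWord Z)) := by
  have hcz := count_z_frame hB hi
  have hct := count_t_frame hB hj
  have hct' := count_t_frame hB hi
  have hvi := restrict_zt_self hw hB h hi
  rcases frame_sublist_cases hB hi hj with h1 | ⟨hij, h1⟩ | ⟨hij, h1⟩
  · have h2 : restrict [Letter.z i, Letter.t j] (frame A B (zWord Z)) =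
        [Letter.z i, Letter.t j, Letter.z i] := by
      refine restrict_eq_of_sublist h1 (by simp) ?_
      rw [length_restrict_cons (by simp), length_restrict_cons (by simp), hcz, hct]
      simp
    rw [h2]
    exact restrict_eq_of_enclosed hw h (by simp) h2
  · have h2 : restrict [Letter.t j, Letter.z i, Letter.t i] (frame A B (zWord Z)) =
        [Letter.t j, Letter.z i, Letter.t i, Letter.z i] := by
      refine restrict_eq_of_sublist h1 (by simp) ?_
      rw [length_restrict_cons (by simp [hij.symm]), length_restrict_cons (by simp),
        length_restrict_cons (by simp), hcz, hct, hct']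
      simp
    suffices h3 : restrict [Letter.t j, Letter.z i, Letter.t i] v =
        [Letter.t j, Letter.z i, Letter.t i, Letter.z i] from
      restrict_eq_of_subset (by simp) (h3.trans h2.symm)
    obtain ⟨c, y, s, hcy, hf⟩ := hw.before
    let φ : Letter → List Letter := fun l =>
      if l = Letter.t j then [c] else if l = Letter.z i then [y] else if l = Letter.t i then s
      else []
    have hφ : ∀ l, l ∉ [Letter.t j, Letter.z i, Letter.t i] → φ l = [] := by
      intro l hl
      simp only [List.mem_cons, List.not_mem_nil, or_false, not_or] at hl
      simp [φ, hl.1, hl.2]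
    have hu' : (frame A B (zWord Z)).flatMap φ = [c, y] ++ s ++ [y] := by
      rw [← flatMap_restrict hφ, h2]; simp [φ, hij]
    have hv : v.flatMap φ = [c, y] ++ s ++ [y] := by rw [← hu', h φ (Or.inl (hu' ▸ hf))]
    rw [← flatMap_restrict hφ] at hv
    have e1 : restrict [Letter.z i, Letter.t i] (restrict [Letter.t j, Letter.z i, Letter.t i] v) =
        [Letter.z i, Letter.t i, Letter.z i] := by rw [restrict_restrict (by simp), hvi]
    have e2 : (restrict [Letter.t j, Letter.z i, Letter.t i] v).count (Letter.t j) = 1 := by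
      rw [count_restrict (by simp), count_t_eq hw hB h hj]
    have e3 : ∀ l ∈ restrict [Letter.t j, Letter.z i, Letter.t i] v,
        l ∈ [Letter.t j, Letter.z i, Letter.t i] := fun l hl => (mem_restrict.1 hl).2
    generalize restrict [Letter.t j, Letter.z i, Letter.t i] v = r at *
    rcases r with _ | ⟨l, r⟩
    · simp at hv
    have e4 := e3 l (by simp)
    simp only [List.mem_cons, List.not_mem_nil, or_false] at e4
    rcases e4 with rfl | rfl | rfl
    · have e5 : Letter.t j ∉ r := by simpa [List.count_eq_zero] using e2
      rw [restrict_cons_of_notMem (by simp [hij.symm])] at e1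
      rw [← e1, restrict, List.filter_eq_self.2]
      intro l hl
      have := e3 l (by simp [hl])
      simp only [List.mem_cons, List.not_mem_nil, or_false] at this
      rcases this with rfl | rfl | rfl
      · exact absurd hl e5
      · simp
      · simp
    · simp [φ] at hv
      exact absurd hv.1.symm hcy
    · rw [restrict_cons_of_mem (by simp)] at e1
      simp at e1
  · have h2 : restrict [Letter.z i, Letter.t i, Letter.t j] (frame A B (zWord Z)) =
        [Letter.z i, Letter.t i, Letter.z i, Letter.t j] := by
      refine restrict_eq_of_sublist h1 (by simp) ?_
      rw [length_restrict_cons (by simp), length_restrict_cons (by simp [hij]),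
        length_restrict_cons (by simp), hcz, hct, hct']
      simp
    suffices h3 : restrict [Letter.z i, Letter.t i, Letter.t j] v =
        [Letter.z i, Letter.t i, Letter.z i, Letter.t j] from
      restrict_eq_of_subset (by simp) (h3.trans h2.symm)
    obtain ⟨c, y, s, hcy, hf⟩ := hw.after
    let φ : Letter → List Letter := fun l =>
      if l = Letter.t j then [c] else if l = Letter.z i then [y] else if l = Letter.t i then s
      else []
    have hφ : ∀ l, l ∉ [Letter.z i, Letter.t i, Letter.t j] → φ l = [] := by
      intro l hl
      simp only [List.mem_cons, List.not_mem_nil, or_false, not_or] at hl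
      simp [φ, hl.1, hl.2]
    have hu' : (frame A B (zWord Z)).flatMap φ = [y] ++ s ++ [y, c] := by
      rw [← flatMap_restrict hφ, h2]; simp [φ, hij]
    have hv : v.flatMap φ = [y] ++ s ++ [y, c] := by rw [← hu', h φ (Or.inl (hu' ▸ hf))]
    rw [← flatMap_restrict hφ] at hv
    have e1 : restrict [Letter.z i, Letter.t i] (restrict [Letter.z i, Letter.t i, Letter.t j] v) =
        [Letter.z i, Letter.t i, Letter.z i] := by rw [restrict_restrict (by simp), hvi]
    have e2 : (restrict [Letter.z i, Letter.t i, Letter.t j] v).count (Letter.t j) = 1 := by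
      rw [count_restrict (by simp), count_t_eq hw hB h hj]
    have e3 : ∀ l ∈ restrict [Letter.z i, Letter.t i, Letter.t j] v,
        l ∈ [Letter.z i, Letter.t i, Letter.t j] := fun l hl => (mem_restrict.1 hl).2
    generalize restrict [Letter.z i, Letter.t i, Letter.t j] v = r at *
    rcases List.eq_nil_or_concat r with rfl | ⟨r, l, rfl⟩
    · simp at hv
    rw [List.concat_eq_append] at *
    have e4 := e3 l (by simp)
    simp only [List.mem_cons, List.not_mem_nil, or_false] at e4
    rcases e4 with rfl | rfl | rfl
    · have hv' : r.flatMap φ ++ [y] = ([y] ++ s ++ [y]) ++ [c] := by simpa [φ] using hv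
      exact absurd (by simpa using (List.append_inj' hv' rfl).2) hcy.symm
    · rw [restrict_append, restrict_cons_of_mem (by simp)] at e1
      have e1' : restrict [Letter.z i, Letter.t i] r ++ [Letter.t i] =
        [Letter.z i, Letter.t i] ++ [Letter.z i] := by simpa using e1
      simpa using (List.append_inj' e1' rfl).2
    · have e5 : Letter.t j ∉ r := by simpa [List.count_eq_zero] using e2
      rw [restrict_append, restrict_cons_of_notMem (by simp [hij.symm])] at e1
      have e6 : restrict [Letter.z i, Letter.t i] r = r := by
        rw [restrict, List.filter_eq_self.2]
        intro l hl
        have := e3 l (by simp [hl])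
        simp only [List.mem_cons, List.not_mem_nil, or_false] at this
        rcases this with rfl | rfl | rfl
        · simp
        · simp
        · exact absurd hl e5
      rw [e6] at e1
      have : r = [Letter.z i, Letter.t i, Letter.z i] := by simpa using e1
      rw [this]; rfl

end skeleton

/-- The linear letters `s` and `t` cut the word into three pieces whose contents are known; only the
order of `a` and `b` in the middle piece is open. -/
theorem eq_of_restrict_pairs {a s b t : Letter} (has : a ≠ s) (hab : a ≠ b) (hat : a ≠ t)
    (hsb : s ≠ b) (hst : s ≠ t) (hbt : b ≠ t) {r : List Letter} (hr : ∀ l ∈ r, l ∈ [a, s, b, t])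
    (h1 : restrict [a, s] r = [a, s, a]) (h2 : restrict [b, t] r = [b, t, b])
    (h3 : restrict [b, s] r = [s, b, b]) (h4 : restrict [a, t] r = [a, a, t]) :
    r = [a, s, a, b, t, b] ∨ r = [a, s, b, a, t, b] := by
  have has' := has.symm
  have hab' := hab.symm
  have hat' := hat.symm
  have hsb' := hsb.symm
  have hst' := hst.symm
  have hbt' := hbt.symm
  simp only [restrict] at *
  rcases r with _ | ⟨l, r⟩
  · simp at h1
  obtain ⟨hl, hr⟩ := List.forall_mem_cons.1 hr
  simp only [List.mem_cons, List.not_mem_nil, or_false] at hl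
  rcases hl with rfl | rfl | rfl | rfl <;> simp_all
  rcases r with _ | ⟨l, r⟩
  · simp at h1
  obtain ⟨hl, hr⟩ := List.forall_mem_cons.1 hr
  rcases hl with rfl | rfl | rfl | rfl <;> simp_all
  rcases r with _ | ⟨l, r⟩
  · simp at h1
  obtain ⟨hl, hr⟩ := List.forall_mem_cons.1 hr
  rcases hl with rfl | rfl | rfl | rfl <;> simp_all
  · rcases r with _ | ⟨l, r⟩
    · simp at h2
    obtain ⟨hl, hr⟩ := List.forall_mem_cons.1 hr
    rcases hl with rfl | rfl | rfl | rfl <;> simp_all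
    rcases r with _ | ⟨l, r⟩
    · simp at h2
    obtain ⟨hl, hr⟩ := List.forall_mem_cons.1 hr
    rcases hl with rfl | rfl | rfl | rfl <;> simp_all
    rcases r with _ | ⟨l, r⟩
    · simp at h2
    obtain ⟨hl, hr⟩ := List.forall_mem_cons.1 hr
    rcases hl with rfl | rfl | rfl | rfl
    simp_all
    rcases r with _ | ⟨l, r⟩
    · rfl
    · exact absurd List.mem_cons_self (h2 l)
  · rcases r with _ | ⟨l, r⟩
    · simp at h2
    obtain ⟨hl, hr⟩ := List.forall_mem_cons.1 hr
    rcases hl with rfl | rfl | rfl | rfl <;> simp_all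
    rcases r with _ | ⟨l, r⟩
    · simp at h2
    obtain ⟨hl, hr⟩ := List.forall_mem_cons.1 hr
    rcases hl with rfl | rfl | rfl | rfl <;> simp_all
    rcases r with _ | ⟨l, r⟩
    · simp at h2
    obtain ⟨hl, hr⟩ := List.forall_mem_cons.1 hr
    rcases hl with rfl | rfl | rfl | rfl
    simp_all
    rcases r with _ | ⟨l, r⟩
    · rfl
    · exact absurd List.mem_cons_self (h2 l)

section skeleton

variable {w v : List Letter} {A B Z : List ℕ}

/-- Restricted to `z_a, t_a, z_b, t_b`, each of the two words is one of two candidates. The pattern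
`crossing` is the image of one of them and not of the other, and an identity applies in both
directions, so the candidates agree. -/
theorem restrict_zz (hw : HasPatterns w) (hB : BlockBalanced A B Z)
    (h : IsIdentityOf w (frame A B (zWord Z)) v) {a b : ℕ} (ha : a ∈ A) (hb : b ∈ B) :
    restrict [Letter.z a, Letter.z b] v =
      restrict [Letter.z a, Letter.z b] (frame A B (zWord Z)) := by
  have haZ := hB.mem_iff.2 (Or.inl ha)
  have hbZ := hB.mem_iff.2 (Or.inr hb)
  have hab : a ≠ b := fun hab => hB.not_mem_both ha (hab ▸ hb)
  set S := [Letter.z a, Letter.t a, Letter.z b, Letter.t b] with hS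
  set u := frame A B (zWord Z) with hu
  have hlen : (restrict S u).length = 6 := by
    rw [length_restrict_cons (by simp [hab]), length_restrict_cons (by simp [hab]),
      length_restrict_cons (by simp), length_restrict_cons (by simp), count_z_frame hB haZ,
      count_t_frame hB haZ, count_z_frame hB hbZ, count_t_frame hB hbZ]
    simp
  have hA : [Letter.z a, Letter.t a].Sublist (ztWord A) := by
    simpa [ztWord] using (List.singleton_sublist.2 ha).flatMap fun i => [Letter.z i, Letter.t i]
  have hB' : [Letter.t b, Letter.z b].Sublist (tzWord B) := by
    simpa [tzWord] using (List.singleton_sublist.2 hb).flatMap fun i => [Letter.t i, Letter.z i]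
  have hus : restrict S u = [Letter.z a, Letter.t a, Letter.z a, Letter.z b, Letter.t b, Letter.z b]
      ∨ restrict S u = [Letter.z a, Letter.t a, Letter.z b, Letter.z a, Letter.t b, Letter.z b] := by
    rcases exists_sublist_pair haZ hbZ hab with h1 | h1
    · left
      refine restrict_eq_of_sublist ?_ (by simp [hS]) (by rw [hlen]; simp)
      simpa [frame, hu, zWord] using (hA.append (h1.map Letter.z)).append hB'
    · right
      refine restrict_eq_of_sublist ?_ (by simp [hS]) (by rw [hlen]; simp)
      simpa [frame, hu, zWord] using (hA.append (h1.map Letter.z)).append hB'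
  have hvs : restrict S v = [Letter.z a, Letter.t a, Letter.z a, Letter.z b, Letter.t b, Letter.z b]
      ∨ restrict S v = [Letter.z a, Letter.t a, Letter.z b, Letter.z a, Letter.t b, Letter.z b] := by
    have key : ∀ i ∈ Z, ∀ j ∈ Z, Letter.z i ∈ S → Letter.t j ∈ S →
        restrict [Letter.z i, Letter.t j] (restrict S v) =
          restrict [Letter.z i, Letter.t j] (restrict S u) := by
      intro i hi j hj h1 h2
      have hsub : [Letter.z i, Letter.t j] ⊆ S := by
        intro l hl
        simp only [List.mem_cons, List.not_mem_nil, or_false] at hl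
        rcases hl with rfl | rfl <;> assumption
      rw [restrict_restrict hsub, restrict_restrict hsub, restrict_zt hw hB h hi hj]
    have k1 := key a haZ a haZ (by simp [hS]) (by simp [hS])
    have k2 := key b hbZ b hbZ (by simp [hS]) (by simp [hS])
    have k3 := key b hbZ a haZ (by simp [hS]) (by simp [hS])
    have k4 := key a haZ b hbZ (by simp [hS]) (by simp [hS])
    refine eq_of_restrict_pairs (by simp) (by simp [hab]) (by simp) (by simp) (by simp [hab])
      (by simp) (fun l hl => (mem_restrict.1 hl).2) (k1.trans ?_) (k2.trans ?_) (k3.trans ?_)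
      (k4.trans ?_) <;>
    rcases hus with hus | hus <;> rw [hus] <;> simp [restrict, hab, hab.symm]
  suffices restrict S v = restrict S u from restrict_eq_of_subset (by simp [hS]) this
  obtain ⟨y, y', α, β, hyy, hf⟩ := hw.crossing
  let φ : Letter → List Letter := fun l =>
    if l = Letter.z a then [y] else if l = Letter.t a then α else if l = Letter.z b then [y']
    else if l = Letter.t b then β else []
  have hφ : ∀ l, l ∉ S → φ l = [] := by
    intro l hl
    simp only [hS, List.mem_cons, List.not_mem_nil, or_false, not_or] at hl
    simp [φ, hl.1, hl.2]
  have hbad : [y] ++ α ++ [y, y'] ++ β ++ [y'] ≠ [y] ++ α ++ [y', y] ++ β ++ [y'] := by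
    simp [hyy]
  have hf1 : [Letter.z a, Letter.t a, Letter.z a, Letter.z b, Letter.t b, Letter.z b].flatMap φ =
      [y] ++ α ++ [y, y'] ++ β ++ [y'] := by simp [φ, hab.symm]
  have hf2 : [Letter.z a, Letter.t a, Letter.z b, Letter.z a, Letter.t b, Letter.z b].flatMap φ =
      [y] ++ α ++ [y', y] ++ β ++ [y'] := by simp [φ, hab.symm]
  have hid := h φ
  rw [← flatMap_restrict hφ, ← flatMap_restrict (u := v) hφ] at hid
  rcases hus with hus | hus <;> rcases hvs with hvs | hvs
  · rw [hus, hvs]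
  · rw [hus, hvs, hf1, hf2] at hid
    exact absurd (hid (Or.inr hf)) hbad
  · rw [hus, hvs, hf1, hf2] at hid
    exact absurd (hid (Or.inl hf)).symm hbad
  · rw [hus, hvs]

/-- Of two consecutive letters of the main block, one comes from each side of the frame. -/
def IsAlternating (A B Z : List ℕ) : Prop :=
  Z.IsChain fun i j => (i ∈ A ∧ j ∈ B) ∨ (i ∈ B ∧ j ∈ A)

/-- The factor monoid of a word with the required patterns identifies a frame with alternating main
block only with itself. -/
theorem frame_rigid (hw : HasPatterns w) (hB : BlockBalanced A B Z) (hZ : IsAlternating A B Z)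
    (hZn : Z ≠ []) (h : IsIdentityOf w (frame A B (zWord Z)) v) : v = frame A B (zWord Z) := by
  have hwn : w ≠ [] := by
    rintro rfl
    obtain ⟨y, b, -, -, hf⟩ := hw.enclosed
    simp at hf
  have hsub := h.subset hwn
  have hzt : ∀ i ∈ Z, ∀ j ∈ Z, restrict [Letter.z i, Letter.t j] v =
      restrict [Letter.z i, Letter.t j] (frame A B (zWord Z)) :=
    fun i hi j hj => restrict_zt hw hB h hi hj
  have htz : ∀ i ∈ Z, ∀ j ∈ Z, restrict [Letter.t j, Letter.z i] v =
      restrict [Letter.t j, Letter.z i] (frame A B (zWord Z)) := by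
    intro i hi j hj
    rw [restrict_swap, hzt i hi j hj, restrict_swap]
  have hzz : (zWord Z).IsChain fun a b => restrict [a, b] v =
      restrict [a, b] (frame A B (zWord Z)) := by
    rw [zWord, List.isChain_map]
    refine hZ.imp ?_
    rintro i j (⟨hi, hj⟩ | ⟨hi, hj⟩)
    · exact restrict_zz hw hB h hi hj
    · rw [restrict_swap, restrict_zz hw hB h hj hi, restrict_swap]
      rfl
  refine eq_of_restrict_consecutive ?_ ?_
  · intro l
    by_cases hl : l ∈ frame A B (zWord Z)
    · rcases l with _ | i | i
      · simp [frame] at hl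
      · have hi : i ∈ Z := by
          simp only [frame, List.mem_append, mem_ztWord, mem_zWord, mem_tzWord] at hl
          rcases hl with (hl | hl) | hl
          · exact hB.mem_iff.2 (Or.inl hl)
          · exact hl
          · exact hB.mem_iff.2 (Or.inr hl)
        rw [count_z_eq hw hB h hi, count_z_frame hB hi]
      · have hi : i ∈ Z := by simpa [frame, hB.mem_iff] using hl
        rw [count_t_eq hw hB h hi, count_t_frame hB hi]
    · rw [List.count_eq_zero.2 hl, List.count_eq_zero.2 fun hv => hl (hsub hv)]
  -- Consecutive letters are a `z` and a `t`, or two `z` of the main block. The latter come from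
  -- different sides of the frame because the block alternates, which is what `restrict_zz` needs.
  · change (ztWord A ++ zWord Z ++ tzWord B).IsChain _
    generalize frame A B (zWord Z) = u at hzt htz hzz
    have hAZ : ∀ i ∈ A, i ∈ Z := fun i hi => hB.mem_iff.2 (Or.inl hi)
    have hBZ : ∀ i ∈ B, i ∈ Z := fun i hi => hB.mem_iff.2 (Or.inr hi)
    have h1 : (ztWord A).IsChain fun a b => restrict [a, b] v = restrict [a, b] u := by
      clear hB hZ h hsub
      induction A with
      | nil => simp
      | cons i A ih =>
        have ih := ih fun j hj => hAZ j (by simp [hj])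
        have hi := hAZ i (by simp)
        rcases A with _ | ⟨j, A⟩
        · simpa using hzt i hi i hi
        · simp only [ztWord_cons, List.isChain_cons_cons] at ih ⊢
          exact ⟨hzt i hi i hi, htz j (hAZ j (by simp)) i hi, ih⟩
    have h2 : (tzWord B).IsChain fun a b => restrict [a, b] v = restrict [a, b] u := by
      clear hB hZ h hsub
      induction B with
      | nil => simp
      | cons i B ih =>
        have ih := ih fun j hj => hBZ j (by simp [hj])
        have hi := hBZ i (by simp)
        rcases B with _ | ⟨j, B⟩
        · simpa using htz i hi i hi
        · simp only [tzWord_cons, List.isChain_cons_cons] at ih ⊢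
          exact ⟨htz i hi i hi, hzt i hi j (hBZ j (by simp)), ih⟩
    rw [List.isChain_append, List.isChain_append]
    refine ⟨⟨h1, hzz, ?_⟩, h2, ?_⟩
    · intro a ha b hb
      rcases Z with _ | ⟨k, Z⟩
      · exact absurd rfl hZn
      simp only [zWord_cons, List.head?_cons, Option.mem_some_iff] at hb
      subst hb
      rcases List.eq_nil_or_concat A with rfl | ⟨A, i, rfl⟩
      · simp at ha
      · simp at ha
        subst ha
        exact htz k (by simp) i (hAZ i (by simp))
    · intro a ha b hb
      rcases B with _ | ⟨i, B⟩
      · simp at hb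
      simp only [tzWord_cons, List.head?_cons, Option.mem_some_iff] at hb
      subst hb
      rcases List.eq_nil_or_concat Z with rfl | ⟨Z, k, rfl⟩
      · exact absurd rfl hZn
      · simp at ha
        subst ha
        exact hzt k (by simp) i (hBZ i (by simp))

end skeleton

/-! ### Renamings and the position of `x` -/

/-- The substitution that renames the indices of letters, erasing those sent to `none`. -/
def renameLetter (π : ℕ → Option ℕ) : Letter → List Letter
  | Letter.x => [Letter.x]
  | Letter.z i => ((π i).map Letter.z).toList
  | Letter.t i => ((π i).map Letter.t).toList

section rename

variable {π : ℕ → Option ℕ} {A B X₁ Y X₂ : List ℕ}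

theorem flatMap_renameLetter_zWord (Z : List ℕ) :
    (zWord Z).flatMap (renameLetter π) = zWord (Z.filterMap π) := by
  induction Z with
  | nil => rfl
  | cons i Z ih => rcases h : π i with _ | j <;> simp [ih, renameLetter, h]

theorem flatMap_renameLetter_ztWord (Z : List ℕ) :
    (ztWord Z).flatMap (renameLetter π) = ztWord (Z.filterMap π) := by
  induction Z with
  | nil => rfl
  | cons i Z ih => rcases h : π i with _ | j <;> simp [ih, renameLetter, h]

theorem flatMap_renameLetter_tzWord (Z : List ℕ) :
    (tzWord Z).flatMap (renameLetter π) = tzWord (Z.filterMap π) := by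
  induction Z with
  | nil => rfl
  | cons i Z ih => rcases h : π i with _ | j <;> simp [ih, renameLetter, h]

theorem flatMap_renameLetter_sandwich :
    (sandwich A B X₁ Y X₂).flatMap (renameLetter π) =
      sandwich (A.filterMap π) (B.filterMap π) (X₁.filterMap π) (Y.filterMap π)
        (X₂.filterMap π) := by
  simp [sandwich, frame, flatMap_renameLetter_zWord, flatMap_renameLetter_ztWord,
    flatMap_renameLetter_tzWord, renameLetter]

/-- The renaming `π` determines the position of `x` relative to a letter that keeps its own name
under `π`. -/
theorem restrict_eq_of_renameLetter {w u v : List Letter} (h : IsIdentityOf w u v) {i j : ℕ}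
    (hi : π i = some j) (hj : ∀ k, π k = some j → k = i)
    (hu : u.flatMap (renameLetter π) <:+: w) :
    restrict [Letter.x, Letter.z i] v = restrict [Letter.x, Letter.z i] u := by
  let g : Letter → Option Letter := fun l =>
    if l = Letter.x then some Letter.x else if l = Letter.z j then some (Letter.z i) else none
  have key : ∀ r : List Letter, (r.flatMap (renameLetter π)).filterMap g =
      restrict [Letter.x, Letter.z i] r := by
    intro r
    induction r with
    | nil => rfl
    | cons l r ih =>
      rw [List.flatMap_cons, List.filterMap_append, ih]
      rcases l with _ | k | k
      · simp [renameLetter, g, restrict_cons_of_mem]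
      · by_cases hk : k = i
        · subst hk
          simp [renameLetter, g, restrict_cons_of_mem, hi]
        · rw [restrict_cons_of_notMem (by simp [hk])]
          rcases hπ : π k with _ | m
          · simp [renameLetter, hπ]
          · have : m ≠ j := fun hm => hk (hj k (hm ▸ hπ))
            simp [renameLetter, hπ, g, this]
      · rw [restrict_cons_of_notMem (by simp)]
        rcases hπ : π k with _ | m <;> simp [renameLetter, hπ, g]
  rw [← key, ← key, h _ (Or.inl hu)]

end rename

theorem exists_append_of_count_eq_two {l : Letter} {v : List Letter} (h : v.count l = 2) :
    ∃ a b c, v = a ++ l :: (b ++ l :: c) ∧ l ∉ a ∧ l ∉ b ∧ l ∉ c := by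
  obtain ⟨a, r, rfl, ha⟩ := List.eq_append_cons_of_mem
    (List.count_pos_iff.1 (by omega : 0 < v.count l))
  have h1 : r.count l = 1 := by simpa [List.count_eq_zero.2 ha] using h
  obtain ⟨b, c, rfl, hb⟩ := List.eq_append_cons_of_mem
    (List.count_pos_iff.1 (by omega : 0 < r.count l))
  have h2 : c.count l = 0 := by simpa [List.count_eq_zero.2 hb] using h1
  exact ⟨a, b, c, rfl, ha, hb, List.count_eq_zero.1 h2⟩

/-- An identity of a factor monoid with the required patterns moves the letter `x` in a sandwich
word only inside the main block, and not over letters whose position is recognised. -/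
theorem sandwich_of_isIdentityOf {w v : List Letter} {A B Z X₁ Y X₂ : List ℕ}
    (hw : HasPatterns w) (hB : BlockBalanced A B Z) (hA : IsAlternating A B Z)
    (hZ : X₁ ++ Y ++ X₂ = Z) (h : IsIdentityOf w (sandwich A B X₁ Y X₂) v) {i j : ℕ}
    (hi : i ∈ Y) (hj : j ∈ Y) (hij : i ≠ j)
    (hvi : restrict [Letter.x, Letter.z i] v =
      restrict [Letter.x, Letter.z i] (sandwich A B X₁ Y X₂))
    (hvj : restrict [Letter.x, Letter.z j] v =
      restrict [Letter.x, Letter.z j] (sandwich A B X₁ Y X₂)) :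
    ∃ X₁' Y' X₂', X₁' ++ Y' ++ X₂' = Z ∧ i ∈ Y' ∧ j ∈ Y' ∧ v = sandwich A B X₁' Y' X₂' := by
  have hZn : Z ≠ [] := by
    rintro rfl
    simp only [List.append_eq_nil_iff] at hZ
    simp [hZ.1.2] at hi
  have hskel : v.filter (· ≠ Letter.x) = frame A B (zWord Z) := by
    refine frame_rigid hw hB hA hZn ?_
    rw [← filter_ne_x_sandwich (A := A) (B := B) hZ]
    exact h.filter_ne _
  have hcount : v.count Letter.x = 2 := by
    rw [← count_restrict (S := [Letter.x, Letter.z i]) (by simp), hvi,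
      count_restrict (by simp), count_x_sandwich]
  obtain ⟨V₁, V₂, V₃, rfl, hV₁, hV₂, hV₃⟩ := exists_append_of_count_eq_two hcount
  have hfil : ∀ l : List Letter, Letter.x ∉ l → l.filter (· ≠ Letter.x) = l := by
    intro l hl
    rw [List.filter_eq_self]
    intro a ha
    simpa using fun h' : a = Letter.x => hl (h' ▸ ha)
  have hsk : V₁ ++ V₂ ++ V₃ = frame A B (zWord Z) := by
    rw [← hskel, List.filter_append, List.filter_cons_of_neg (by simp), List.filter_append,
      List.filter_cons_of_neg (by simp), hfil _ hV₁, hfil _ hV₂, hfil _ hV₃, List.append_assoc]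
  have hmem : ∀ k, k ∈ Y →
      restrict [Letter.x, Letter.z k] (V₁ ++ Letter.x :: (V₂ ++ Letter.x :: V₃)) =
        restrict [Letter.x, Letter.z k] (sandwich A B X₁ Y X₂) → Letter.z k ∈ V₂ := by
    intro k hk hr
    have e1 : sandwich A B X₁ Y X₂ = (ztWord A ++ zWord X₁) ++
        Letter.x :: (zWord Y ++ Letter.x :: (zWord X₂ ++ tzWord B)) := by
      simp [sandwich, frame]
    rw [e1, restrict_append, restrict_cons_of_mem (by simp), restrict_append,
      restrict_cons_of_mem (by simp), restrict_append (u := ztWord A ++ zWord X₁),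
      restrict_cons_of_mem (by simp), restrict_append (u := zWord Y),
      restrict_cons_of_mem (by simp)] at hr
    obtain ⟨-, hr2⟩ := append_cons_inj (by simp [hV₁]) (by simp) hr
    obtain ⟨hr3, -⟩ := append_cons_inj (by simp [hV₂]) (by simp) hr2
    have : Letter.z k ∈ restrict [Letter.x, Letter.z k] V₂ := by
      rw [hr3]; simp [hk]
    exact (mem_restrict.1 this).1
  have hiV := hmem i hi hvi
  have hjV := hmem j hj hvj
  have ht : ∀ k, Letter.t k ∉ V₂ := by
    intro k hk
    have hkZ : k ∈ Z := by
      have : Letter.t k ∈ frame A B (zWord Z) := by rw [← hsk]; simp [hk]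
      simpa [frame, hB.mem_iff] using this
    have hc := count_t_frame hB hkZ
    rw [← hsk] at hc
    have hkc := List.count_pos_iff.2 hk
    simp only [List.count_append] at hc
    have hk1 : Letter.t k ∉ V₁ := List.count_eq_zero.1 (by omega)
    have hk3 : Letter.t k ∉ V₃ := List.count_eq_zero.1 (by omega)
    -- A linear letter between the two `x` of `v` would, by the pattern `enclosed`, also separate
    -- those of the sandwich word.
    have e2 : restrict [Letter.x, Letter.t k] (V₁ ++ Letter.x :: (V₂ ++ Letter.x :: V₃)) =
        [Letter.x, Letter.t k, Letter.x] := by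
      refine restrict_eq_of_sublist ?_ (by simp) ?_
      · refine List.Sublist.trans ?_ (List.sublist_append_right _ _)
        refine List.Sublist.cons_cons _ ?_
        exact (List.singleton_sublist.2 hk).append (by simp)
      · rw [length_restrict_cons (by simp), length_restrict_cons (by simp), hcount]
        simp
        omega
    have e3 := restrict_eq_of_enclosed hw h.symm (by simp) e2
    have e4 : restrict [Letter.x, Letter.t k] (sandwich A B X₁ Y X₂) =
        restrict [Letter.x, Letter.t k] (ztWord A ++ zWord X₁) ++ Letter.x :: Letter.x ::
          restrict [Letter.x, Letter.t k] (zWord X₂ ++ tzWord B) := by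
      have : restrict [Letter.x, Letter.t k] (zWord Y) = [] := by
        refine restrict_eq_nil ?_
        intro l hl
        obtain ⟨m, -, rfl⟩ := List.mem_map.1 hl
        simp
      simp [sandwich, frame, this, restrict_cons_of_mem]
    rw [e4] at e3
    generalize restrict [Letter.x, Letter.t k] (ztWord A ++ zWord X₁) = W at e3
    rcases W with _ | ⟨a, _ | ⟨b, _ | ⟨c, W⟩⟩⟩ <;> simp at e3
  have hlen : 2 ≤ V₂.length := by
    rcases V₂ with _ | ⟨a, _ | ⟨b, V₂⟩⟩
    · simp at hiV
    · simp only [List.mem_singleton] at hiV hjV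
      exact absurd (Letter.z.inj (hiV.trans hjV.symm)) hij
    · simp
  obtain ⟨s₁, s₂, rfl, rfl, h3⟩ := localize hsk ht hlen
  obtain ⟨L, X₂', rfl, h4, rfl⟩ := List.map_eq_append_iff.1 h3
  obtain ⟨X₁', Y', rfl, rfl, rfl⟩ := List.map_eq_append_iff.1 h4
  refine ⟨X₁', Y', X₂', rfl, by simpa using hiV, by simpa using hjV, ?_⟩
  simp [sandwich, frame, zWord]

/-! ### The right language, markers, and closure under the identities of `M(w)` -/

/-- The words that arise from the sandwich word with main block `x P Q x` by moving the second `x`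
inside `Q`. -/
def rightLanguage (A B P Q : List ℕ) : Set (List Letter) :=
  {u | ∃ Q₁ Q₂, Q₁ ++ Q₂ = Q ∧ u = sandwich A B [] (P ++ Q₁) Q₂}

theorem mem_rightLanguage_iff {A B P Q : List ℕ} {u : List Letter} :
    u ∈ rightLanguage A B P Q ↔
      u.reverse ∈ leftLanguage B.reverse A.reverse Q.reverse P.reverse := by
  constructor
  · rintro ⟨Q₁, Q₂, rfl, rfl⟩
    exact ⟨Q₂.reverse, Q₁.reverse, by simp, by simp [reverse_sandwich]⟩
  · rintro ⟨P₁, P₂, h1, h2⟩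
    refine ⟨P₂.reverse, P₁.reverse, ?_, ?_⟩
    · simpa using congrArg List.reverse h1
    · simpa [reverse_sandwich] using congrArg List.reverse h2

/-- The mirror image of `leftLanguage_substitution`, with reversed letter images and exchanged
contexts. -/
theorem rightLanguage_substitution {A B S : List ℕ} {c₀ e₁ c₂ e₂ c₁ : ℕ}
    (hB : BlockBalanced A B (S ++ [c₁, e₂, c₂, e₁, c₀]))
    (hr : IsRigidStart B.reverse A.reverse c₀ e₁ c₂ e₂ c₁) (φ : Letter → List Letter)
    (p q : List Letter) :
    p ++ (sandwich A B [] (S ++ [c₁, e₂, c₂, e₁, c₀]) []).flatMap φ ++ q ∈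
        rightLanguage A B (S ++ [c₁, e₂, c₂]) [e₁, c₀] ↔
      p ++ (sandwich A B [] (S ++ [c₁, e₂, c₂]) [e₁, c₀]).flatMap φ ++ q ∈
        rightLanguage A B (S ++ [c₁, e₂, c₂]) [e₁, c₀] := by
  have h1 := hB.reverse
  simp only [List.reverse_append, List.reverse_cons, List.reverse_nil, List.nil_append,
    List.cons_append] at h1
  have h2 := leftLanguage_substitution h1 hr (fun l => (φ l).reverse) q.reverse p.reverse
  simp only [mem_rightLanguage_iff, List.reverse_append, List.reverse_flatMap, reverse_sandwich,
    Function.comp_def, List.reverse_cons, List.reverse_nil, List.nil_append, List.cons_append]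
  simpa using h2

/-- Some renaming of the sandwich word to `w` keeps the index `i` and erases the indices `N`. -/
def IsMarker (w : List Letter) (A B Z N : List ℕ) (i : ℕ) : Prop :=
  ∃ π : ℕ → Option ℕ, (∃ j, π i = some j ∧ ∀ k, π k = some j → k = i) ∧ (∀ k ∈ N, π k = none) ∧
    sandwich (A.filterMap π) (B.filterMap π) [] (Z.filterMap π) [] = w

/-- The renaming erases all letters of the block outside the two `x`, so it sends this sandwich word
to `w` no matter where exactly the `x` stand among the letters of `N`. -/
theorem IsMarker.restrict_eq {w v : List Letter} {A B Z N X₁ Y X₂ : List ℕ} {i : ℕ}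
    (hm : IsMarker w A B Z N i) (hZ : X₁ ++ Y ++ X₂ = Z) (h₁ : ∀ k ∈ X₁, k ∈ N)
    (h₂ : ∀ k ∈ X₂, k ∈ N) (h : IsIdentityOf w (sandwich A B X₁ Y X₂) v) :
    restrict [Letter.x, Letter.z i] v =
      restrict [Letter.x, Letter.z i] (sandwich A B X₁ Y X₂) := by
  obtain ⟨π, ⟨j, hi, hj⟩, hN, hπ⟩ := hm
  refine restrict_eq_of_renameLetter h hi hj ?_
  have e1 : X₁.filterMap π = [] := List.filterMap_eq_nil_iff.2 fun k hk => hN k (h₁ k hk)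
  have e2 : X₂.filterMap π = [] := List.filterMap_eq_nil_iff.2 fun k hk => hN k (h₂ k hk)
  have e3 : Z.filterMap π = Y.filterMap π := by rw [← hZ]; simp [e1, e2]
  rw [flatMap_renameLetter_sandwich, e1, e2, ← e3, hπ]

theorem split_of_mem_right {X Y I : List ℕ} {a b c : ℕ} (hnd : (a :: b :: c :: I).Nodup)
    (h : X ++ Y = a :: b :: c :: I) (hc : c ∈ Y) :
    ∃ P₂, X ++ P₂ = [a, b] ∧ Y = P₂ ++ c :: I := by
  rcases X with _ | ⟨x₁, _ | ⟨x₂, _ | ⟨x₃, X⟩⟩⟩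
  · exact ⟨[a, b], by simp, by simpa using h⟩
  · simp only [List.cons_append, List.nil_append, List.cons.injEq] at h
    exact ⟨[b], by simp [h.1], by simp [h.2]⟩
  · simp only [List.cons_append, List.nil_append, List.cons.injEq] at h
    exact ⟨[], by simp [h.1, h.2.1], by simp [h.2.2]⟩
  · simp only [List.cons_append, List.cons.injEq] at h
    obtain ⟨rfl, rfl, rfl, rfl⟩ := h
    simp [hc] at hnd

theorem eq_nil_of_mem_of_append_singleton {X Y S : List ℕ} {c : ℕ} (hnd : (S ++ [c]).Nodup)
    (h : Y ++ X = S ++ [c]) (hc : c ∈ Y) : X = [] := by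
  rcases List.eq_nil_or_concat X with rfl | ⟨X, d, rfl⟩
  · rfl
  · have h' : (Y ++ X) ++ [d] = S ++ [c] := by simpa using h
    obtain ⟨rfl, h2⟩ := List.append_inj' h' rfl
    simp only [List.nodup_append] at hnd
    exact absurd rfl (hnd.2.2 c (by simp [hc]) c (by simp))

/-- Both markers remain between the two `x`. The marker `a₂` stops the first `x` after at most two
letters; the marker `c₀`, the last letter of the block, keeps the second `x` at the end. -/
theorem leftLanguage_closed {w u v : List Letter} {A B S I : List ℕ} {a₀ d₁ a₂ c₀ : ℕ}
    (hw : HasPatterns w) (hB : BlockBalanced A B (a₀ :: d₁ :: a₂ :: I))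
    (hA : IsAlternating A B (a₀ :: d₁ :: a₂ :: I)) (hS : a₀ :: d₁ :: a₂ :: I = S ++ [c₀])
    (hc : c₀ ∈ I) (hm : IsMarker w A B (a₀ :: d₁ :: a₂ :: I) [a₀, d₁] a₂)
    (hm' : IsMarker w A B (a₀ :: d₁ :: a₂ :: I) [a₀, d₁] c₀)
    (hu : u ∈ leftLanguage A B [a₀, d₁] (a₂ :: I)) (h : IsIdentityOf w u v) :
    v ∈ leftLanguage A B [a₀, d₁] (a₂ :: I) := by
  obtain ⟨P₁, P₂, hP, rfl⟩ := hu
  have hZ : P₁ ++ (P₂ ++ a₂ :: I) ++ [] = a₀ :: d₁ :: a₂ :: I := by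
    rw [← List.append_assoc, hP]; simp
  have h1 : ∀ k ∈ P₁, k ∈ [a₀, d₁] := fun k hk => by rw [← hP]; simp [hk]
  have hne : a₂ ≠ c₀ := by
    rintro rfl
    have := hB.nodup
    simp [hc] at this
  obtain ⟨X₁, Y, X₂, hZ', hi, hj, rfl⟩ := sandwich_of_isIdentityOf hw hB hA hZ h (by simp)
    (by simp [hc]) hne (hm.restrict_eq hZ h1 (by simp) h) (hm'.restrict_eq hZ h1 (by simp) h)
  have hX₂ : X₂ = [] := eq_nil_of_mem_of_append_singleton (Y := X₁ ++ Y) (hS ▸ hB.nodup)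
    (by rw [hZ', hS]) (by simp [hj])
  subst hX₂
  obtain ⟨P₂', hP', rfl⟩ := split_of_mem_right hB.nodup (by simpa using hZ') hi
  exact ⟨X₁, P₂', hP', rfl⟩

/-- Dually, the marker `a₀` keeps the first `x` at the beginning, and `c₂` bounds the movement of
the second `x`. -/
theorem rightLanguage_closed {w u v : List Letter} {A B S T : List ℕ} {a₀ c₂ e₁ c₀ : ℕ}
    (hw : HasPatterns w) (hB : BlockBalanced A B (S ++ [c₂, e₁, c₀]))
    (hA : IsAlternating A B (S ++ [c₂, e₁, c₀])) (hS : S ++ [c₂, e₁, c₀] = a₀ :: T)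
    (ha : a₀ ∈ S) (hm : IsMarker w A B (S ++ [c₂, e₁, c₀]) [e₁, c₀] a₀)
    (hm' : IsMarker w A B (S ++ [c₂, e₁, c₀]) [e₁, c₀] c₂)
    (hu : u ∈ rightLanguage A B (S ++ [c₂]) [e₁, c₀]) (h : IsIdentityOf w u v) :
    v ∈ rightLanguage A B (S ++ [c₂]) [e₁, c₀] := by
  obtain ⟨Q₁, Q₂, hQ, rfl⟩ := hu
  have hZ : [] ++ (S ++ [c₂] ++ Q₁) ++ Q₂ = S ++ [c₂, e₁, c₀] := by simp [hQ]
  have h1 : ∀ k ∈ Q₂, k ∈ [e₁, c₀] := fun k hk => by rw [← hQ]; simp [hk]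
  have hne : a₀ ≠ c₂ := by
    rintro rfl
    have := hB.nodup
    simp [List.nodup_append] at this
    exact (this.2.2 a₀ ha).1 rfl
  obtain ⟨X₁, Y, X₂, hZ', hi, hj, rfl⟩ := sandwich_of_isIdentityOf hw hB hA hZ h (by simp [ha])
    (by simp) hne (hm.restrict_eq hZ (by simp) h1 h) (hm'.restrict_eq hZ (by simp) h1 h)
  have hnd := List.nodup_reverse.2 hB.nodup
  have hrev := congrArg List.reverse hZ'
  have hX₁ : X₁.reverse = [] := by
    rw [hS, List.reverse_cons] at hnd hrev
    exact eq_nil_of_mem_of_append_singleton (Y := X₂.reverse ++ Y.reverse) hnd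
      (by simpa using hrev) (by simp [hi])
  rw [List.reverse_eq_nil_iff] at hX₁
  subst hX₁
  simp only [List.reverse_append, List.reverse_cons, List.reverse_nil, List.nil_append,
    List.cons_append] at hnd hrev
  obtain ⟨Q, hQ', hY⟩ := split_of_mem_right hnd hrev (by simpa using hj)
  refine ⟨Q.reverse, X₂, by simpa using congrArg List.reverse hQ', ?_⟩
  have : Y = S ++ [c₂] ++ Q.reverse := by simpa using congrArg List.reverse hY
  rw [this]

/-! ### Assembly for rigid sandwich words, and the patterns in the given word -/

/-- A word with the required patterns, for which there is a rigid alternating sandwich word with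
enough markers, generates a variety whose lattice of subvarieties is not distributive. -/
theorem not_isDistributiveLattice_of_sandwich {w : Word} {A B Z S T : List ℕ}
    {a₀ d₁ a₂ d₂ a₁ c₀ e₁ c₂ e₂ c₁ : ℕ} (hw : HasPatterns w.toList)
    (hB : BlockBalanced A B Z) (hA : IsAlternating A B Z)
    (hZ : Z = a₀ :: d₁ :: a₂ :: d₂ :: a₁ :: T) (hZ' : Z = S ++ [c₁, e₂, c₂, e₁, c₀])
    (hc : c₀ ∈ T) (ha : a₀ ∈ S)
    (hr : IsRigidStart A B a₀ d₁ a₂ d₂ a₁)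
    (hr' : IsRigidStart B.reverse A.reverse c₀ e₁ c₂ e₂ c₁)
    (h1 : IsMarker w.toList A B Z [a₀, d₁] a₂) (h2 : IsMarker w.toList A B Z [a₀, d₁] c₀)
    (h3 : IsMarker w.toList A B Z [e₁, c₀] a₀) (h4 : IsMarker w.toList A B Z [e₁, c₀] c₂) :
    ¬ IsDistributiveLattice (MonoidVariety.SubvarietyLattice
      (MonoidVariety.generatedBy (MonCat.of (FactorMonoid {w})))) := by
  have hZ'' : Z = S ++ [c₁, e₂] ++ [c₂, e₁, c₀] := by simp [hZ']
  refine not_isDistributiveLattice_of_languages (f := sandwich A B [] Z [])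
    (g := sandwich A B [a₀, d₁] (a₂ :: d₂ :: a₁ :: T) [])
    (h := sandwich A B [] (S ++ [c₁, e₂, c₂]) [e₁, c₀])
    (f₀ := Letter.x :: Letter.x :: frame A B (zWord Z))
    (Lα := leftLanguage A B [a₀, d₁] (a₂ :: d₂ :: a₁ :: T))
    (Lβ := rightLanguage A B (S ++ [c₁, e₂, c₂]) [e₁, c₀]) ?_ ?_ ?_ ?_ ?_ ?_ ?_ ?_ ?_ ?_
  · exact ⟨[], [a₀, d₁], by simp, by simp [hZ]⟩
  · exact ⟨[e₁, c₀], [], by simp, by simp [hZ']⟩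
  · rintro u ⟨P₁, P₂, hP, rfl⟩ ⟨Q₁, Q₂, -, h⟩
    simp only [sandwich, frame, List.append_assoc, List.append_cancel_left_eq, zWord_nil,
      List.nil_append] at h
    -- In the right language the main block starts with `x`, so a common word has `P₁` empty.
    rcases P₁ with _ | ⟨i, P₁⟩
    · simp only [List.nil_append] at hP
      rw [hP, hZ]; rfl
    · simp at h
  · intro u v hu h
    subst hZ
    exact leftLanguage_closed (S := S ++ [c₁, e₂, c₂, e₁]) hw hB hA (by simp [hZ'])
      (by simp [hc]) h1 h2 hu h
  · intro u v hu h
    rw [hZ''] at hB hA h3 h4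
    have hS : S ++ [c₁, e₂, c₂] = (S ++ [c₁, e₂]) ++ [c₂] := by simp
    rw [hS] at hu ⊢
    exact rightLanguage_closed (T := d₁ :: a₂ :: d₂ :: a₁ :: T) hw hB hA
      (by rw [← hZ'', hZ]) (by simp [ha]) h3 h4 hu h
  · intro φ p q
    subst hZ
    exact leftLanguage_substitution hB hr φ p q
  · intro φ p q
    have := rightLanguage_substitution (hZ' ▸ hB) hr' φ p q
    rwa [← hZ'] at this
  · exact isIdentityOf_of_shorter hB (by simp [hZ]) (by simp [hZ])
  · exact isIdentityOf_of_shorter hB (by simp [hZ']) (by simp [hZ'])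
  · intro h
    subst hZ
    -- `f₀` starts with `x x`; `f` starts with a `z`, or with `x` and a `z` if the left side is
    -- empty.
    rcases hAe : A with _ | ⟨i, A⟩
    · simp [sandwich, frame, hAe] at h
    · simp [sandwich, frame, hAe] at h

/-- In general `x` plays the role of `y` in the first three patterns, with the linear letters next
to the main block as `c`; an empty side leaves the words `x z x t z` and `z t x z x`, treated
separately. For `crossing`, a first block letter from the left side crosses `x`; otherwise it
crosses the second block letter, which comes from the left side by alternation. -/
theorem hasPatterns_sandwich {A B Z : List ℕ} (hB : BlockBalanced A B Z)
    (hA : IsAlternating A B Z) (hZ : Z ≠ []) (hAn : A = [] → B.length = 1)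
    (hBn : B = [] → A.length = 1) : HasPatterns (sandwich A B [] Z []) := by
  have hZB : ∀ b, A = [] → B = [b] → Z = [b] := by
    rintro b rfl rfl
    simpa using hB.perm
  have hZA : ∀ a, B = [] → A = [a] → Z = [a] := by
    rintro a rfl rfl
    simpa using hB.perm
  refine ⟨⟨Letter.x, zWord Z, by simp, ?_, ztWord A, tzWord B, by simp [sandwich, frame]⟩,
    ?_, ?_, ?_⟩
  · rw [Ne, ← List.length_eq_zero_iff, length_zWord, List.length_eq_zero_iff]
    exact hZ
  · rcases List.eq_nil_or_concat A with rfl | ⟨A, i, rfl⟩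
    · obtain ⟨b, rfl⟩ := List.length_eq_one_iff.1 (hAn rfl)
      obtain rfl := hZB b rfl rfl
      exact ⟨Letter.x, Letter.z b, [Letter.x, Letter.t b], by simp, [], [],
        by simp [sandwich, frame]⟩
    · exact ⟨Letter.t i, Letter.x, zWord Z, by simp, ztWord A ++ [Letter.z i], tzWord B,
        by simp [sandwich, frame]⟩
  · rcases B with _ | ⟨j, B⟩
    · obtain ⟨a, rfl⟩ := List.length_eq_one_iff.1 (hBn rfl)
      obtain rfl := hZA a rfl rfl
      exact ⟨Letter.x, Letter.z a, [Letter.t a, Letter.x], by simp, [], [],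
        by simp [sandwich, frame]⟩
    · exact ⟨Letter.t j, Letter.x, zWord Z, by simp, ztWord A, Letter.z j :: tzWord B,
        by simp [sandwich, frame]⟩
  · rcases Z with _ | ⟨r, R⟩
    · exact absurd rfl hZ
    rcases hB.mem_iff.1 (List.mem_cons_self (a := r) (l := R)) with hr | hr
    · obtain ⟨A₁, A₂, rfl⟩ := List.append_of_mem hr
      exact ⟨Letter.z r, Letter.x, Letter.t r :: ztWord A₂, zWord R, by simp, ztWord A₁,
        tzWord B, by simp [sandwich, frame]⟩
    · rcases R with _ | ⟨s, R⟩
      · have hAe : A = [] := by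
          rw [List.eq_nil_iff_forall_not_mem]
          intro i hi
          have := hB.mem_iff.2 (Or.inl hi)
          simp only [List.mem_singleton] at this
          subst this
          exact hB.not_mem_both hi hr
        subst hAe
        obtain ⟨b, rfl⟩ := List.length_eq_one_iff.1 (hAn rfl)
        obtain rfl : r = b := by simpa using hr
        exact ⟨Letter.x, Letter.z r, [], [Letter.t r], by simp, [], [], by simp [sandwich, frame]⟩
      · have hs : s ∈ A := by
          rcases (List.isChain_cons_cons.1 hA).1 with h | h
          · exact (hB.not_mem_both h.1 hr).elim
          · exact h.2
        have hrs : r ≠ s := fun h => hB.not_mem_both hs (h ▸ hr)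
        obtain ⟨A₁, A₂, rfl⟩ := List.append_of_mem hs
        obtain ⟨B₁, B₂, rfl⟩ := List.append_of_mem hr
        exact ⟨Letter.z s, Letter.z r, Letter.t s :: ztWord A₂ ++ [Letter.x],
          zWord R ++ [Letter.x] ++ tzWord B₁ ++ [Letter.t r], by simp [hrs.symm], ztWord A₁,
          tzWord B₂, by simp [sandwich, frame]⟩

/-! ### The enlarged sandwich word -/

/-- Around the indices `r` and `l`, insert three new indices each, in the order in which the
letters of these indices have to occur outside the main block. -/
def inflate (k r l i : ℕ) : List ℕ :=
  (if i = r then [k, k + 1, k + 2] else []) ++ [i] ++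
    (if i = l then [k + 5, k + 4, k + 3] else [])

/-- The indices of the separating letters that come from the side of the frame given by `P`. -/
noncomputable def separators (k : ℕ) (P Q : Prop) : List ℕ :=
  open scoped Classical in
  (if P then [k + 6, k + 7, k + 8] else []) ++ (if Q then [k + 9, k + 10, k + 11] else [])

/-- The main block of the enlarged sandwich word. -/
def enlarge (k : ℕ) (Z : List ℕ) : List ℕ :=
  -- The order `k, k + 2, k + 1` against `k, k + 1, k + 2` in `inflate` gives the rigid start, and
  -- `k + 4, k + 5, k + 3` against `k + 5, k + 4, k + 3` the rigid end; the separators `k + 6`, …,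
  -- `k + 11` make the block alternate.
  [k, k + 6, k + 2, k + 7, k + 1, k + 8] ++ Z ++ [k + 11, k + 4, k + 10, k + 5, k + 9, k + 3]

/-- One side of the frame of the enlarged sandwich word. -/
noncomputable def enlargeSide (k r l : ℕ) (A : List ℕ) : List ℕ :=
  -- Separators go to the side opposite to `r` or `l`. Their place within that side is immaterial,
  -- since the markers erase them.
  separators k (r ∉ A) (l ∉ A) ++ A.flatMap (inflate k r l)

section enlarge

variable {k r l : ℕ} {A B Z : List ℕ}

theorem flatMap_ite_eq {L Q : List ℕ} (hL : L.Nodup) (r : ℕ) :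
    L.flatMap (fun i => if i = r then Q else []) = if r ∈ L then Q else [] := by
  induction L with
  | nil => simp
  | cons a L ih =>
    have hL' := List.nodup_cons.1 hL
    rw [List.flatMap_cons, ih hL'.2]
    by_cases h : a = r
    · subst h; simp [hL'.1]
    · simp [h, Ne.symm h]

theorem flatMap_inflate_perm {L : List ℕ} (hL : L.Nodup) :
    (L.flatMap (inflate k r l)).Perm ((if r ∈ L then [k, k + 1, k + 2] else []) ++ L ++
      (if l ∈ L then [k + 5, k + 4, k + 3] else [])) := by
  rw [← flatMap_ite_eq hL r, ← flatMap_ite_eq hL l]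
  have h1 := List.flatMap_append_perm L (fun i => if i = r then [k, k + 1, k + 2] else [])
    (fun i => [i])
  have h2 := List.flatMap_append_perm L
    (fun i => (if i = r then [k, k + 1, k + 2] else []) ++ [i])
    (fun i => if i = l then [k + 5, k + 4, k + 3] else [])
  rw [List.flatMap_singleton'] at h1
  exact h2.symm.trans (h1.symm.append_right _)

theorem blockBalanced_enlarge (hB : BlockBalanced A B Z) (hk : ∀ i ∈ Z, i < k) (hr : r ∈ Z)
    (hl : l ∈ Z) : BlockBalanced (enlargeSide k r l A) (enlargeSide k r l B) (enlarge k Z) := by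
  constructor
  · have h1 : ∀ i, k ≤ i → i ∉ Z := fun i hi h => absurd (hk i h) (by omega)
    simp [enlarge, List.nodup_append, hB.nodup, h1]
    intro a ha
    have := hk a ha
    omega
  · have hside : ∀ i ∈ Z, (i ∈ A ∧ i ∉ B) ∨ (i ∉ A ∧ i ∈ B) := by
      intro i hi
      rcases hB.mem_iff.1 hi with h | h
      · exact Or.inl ⟨h, fun h' => hB.not_mem_both h h'⟩
      · exact Or.inr ⟨fun h' => hB.not_mem_both h' h, h⟩
    refine List.Perm.trans ?_ (((flatMap_inflate_perm hB.nodup_left).append_left _).append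
      ((flatMap_inflate_perm hB.nodup_right).append_left _)).symm
    refine List.perm_iff_count.2 fun i => ?_
    have h1 := hB.perm.count_eq i
    rw [List.count_append] at h1
    rcases hside r hr with h2 | h2 <;> rcases hside l hl with h3 | h3 <;>
      simp [enlarge, separators, h2, h3, List.count_append, List.count_cons, h1] <;> ring

theorem isAlternating_enlarge (hB : BlockBalanced A B Z) (hA : IsAlternating A B Z)
    (hr : Z.head? = some r) (hl : Z.getLast? = some l) :
    IsAlternating (enlargeSide k r l A) (enlargeSide k r l B) (enlarge k Z) := by
  have hrZ : r ∈ Z := List.mem_of_head? hr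
  have hlZ : l ∈ Z := List.mem_of_getLast? hl
  have hsub : ∀ {L : List ℕ} {i}, i ∈ L → i ∈ enlargeSide k r l L := by
    intro L i hi
    simp only [enlargeSide, List.mem_append, List.mem_flatMap]
    exact Or.inr ⟨i, hi, by simp [inflate]⟩
  have hmr : ∀ {L : List ℕ}, r ∈ L → ∀ i ∈ [k, k + 1, k + 2], i ∈ enlargeSide k r l L := by
    intro L hL i hi
    simp only [enlargeSide, List.mem_append, List.mem_flatMap]
    exact Or.inr ⟨r, hL, by simp [inflate] at hi ⊢; tauto⟩
  have hml : ∀ {L : List ℕ}, l ∈ L → ∀ i ∈ [k + 3, k + 4, k + 5], i ∈ enlargeSide k r l L := by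
    intro L hL i hi
    simp only [enlargeSide, List.mem_append, List.mem_flatMap]
    exact Or.inr ⟨l, hL, by simp [inflate] at hi ⊢; tauto⟩
  have hdr : ∀ {L : List ℕ}, r ∉ L → ∀ i ∈ [k + 6, k + 7, k + 8], i ∈ enlargeSide k r l L := by
    intro L hL i hi
    simp only [enlargeSide, List.mem_append, separators, hL]
    exact Or.inl (Or.inl (by simpa using hi))
  have hdl : ∀ {L : List ℕ}, l ∉ L → ∀ i ∈ [k + 9, k + 10, k + 11], i ∈ enlargeSide k r l L := by
    intro L hL i hi
    simp only [enlargeSide, List.mem_append, separators, hL]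
    exact Or.inl (Or.inr (by simpa using hi))
  have hside : ∀ i ∈ Z, (i ∈ A ∧ i ∉ B) ∨ (i ∈ B ∧ i ∉ A) := by
    intro i hi
    rcases hB.mem_iff.1 hi with h | h
    · exact Or.inl ⟨h, fun h' => hB.not_mem_both h h'⟩
    · exact Or.inr ⟨h, fun h' => hB.not_mem_both h' h⟩
  have hmid : Z.IsChain fun i j =>
      (i ∈ enlargeSide k r l A ∧ j ∈ enlargeSide k r l B) ∨
      (i ∈ enlargeSide k r l B ∧ j ∈ enlargeSide k r l A) :=
    hA.imp fun i j h => h.imp (fun h => ⟨hsub h.1, hsub h.2⟩) fun h => ⟨hsub h.1, hsub h.2⟩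
  rw [IsAlternating, enlarge, List.isChain_append, List.isChain_append]
  refine ⟨⟨?_, hmid, ?_⟩, ?_, ?_⟩
  · rcases hside r hrZ with ⟨h1, h2⟩ | ⟨h1, h2⟩ <;>
      simp [hmr h1, hdr h2]
  · rcases hside r hrZ with ⟨h1, h2⟩ | ⟨h1, h2⟩ <;>
      simp [hr, hsub h1, hdr h2]
  · rcases hside l hlZ with ⟨h1, h2⟩ | ⟨h1, h2⟩ <;>
      simp [hml h1, hdl h2]
  · rcases hside l hlZ with ⟨h1, h2⟩ | ⟨h1, h2⟩ <;>
      simp [List.getLast?_cons, hl, hsub h1, hdl h2]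

end enlarge

/-! ### Rigidity and markers of the enlarged word -/

section markers

variable {k r l : ℕ} {A B Z : List ℕ}

theorem inflate_sublist {i : ℕ} (hi : i ∈ A) :
    (inflate k r l i).Sublist (enlargeSide k r l A) :=
  (List.sublist_flatten_of_mem (List.mem_map_of_mem hi)).trans (List.sublist_append_right _ _)

theorem isRigidStart_enlarge_aux (hA : r ∈ A) (hB : r ∉ B) :
    [k, k + 1, k + 2].Sublist (enlargeSide k r l A) ∧ k + 6 ∈ enlargeSide k r l B ∧
      k + 7 ∈ enlargeSide k r l B := by
  refine ⟨List.Sublist.trans ?_ (inflate_sublist hA), ?_, ?_⟩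
  · rw [inflate, if_pos rfl, List.append_assoc]
    exact List.sublist_append_left _ _
  · simp [enlargeSide, separators, hB]
  · simp [enlargeSide, separators, hB]

theorem isRigidEnd_enlarge_aux (hA : l ∈ A) (hB : l ∉ B) :
    [k + 3, k + 4, k + 5].Sublist (enlargeSide k r l A).reverse ∧
      k + 9 ∈ (enlargeSide k r l B).reverse ∧ k + 10 ∈ (enlargeSide k r l B).reverse := by
  refine ⟨?_, ?_, ?_⟩
  · have h : [k + 5, k + 4, k + 3].Sublist (enlargeSide k r l A) := by
      refine List.Sublist.trans ?_ (inflate_sublist hA)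
      rw [inflate, if_pos (rfl : l = l)]
      exact List.sublist_append_right _ _
    simpa using h.reverse
  · simp [enlargeSide, separators, hB]
  · simp [enlargeSide, separators, hB]

theorem isRigidStart_enlarge (hB : BlockBalanced A B Z) (hr : r ∈ Z) :
    IsRigidStart (enlargeSide k r l A) (enlargeSide k r l B) k (k + 6) (k + 2) (k + 7) (k + 1) := by
  rcases hB.mem_iff.1 hr with h | h
  · exact Or.inl (isRigidStart_enlarge_aux h fun h' => hB.not_mem_both h h')
  · exact Or.inr (isRigidStart_enlarge_aux h fun h' => hB.not_mem_both h' h)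

theorem isRigidEnd_enlarge (hB : BlockBalanced A B Z) (hl : l ∈ Z) :
    IsRigidStart (enlargeSide k r l B).reverse (enlargeSide k r l A).reverse
      (k + 3) (k + 9) (k + 5) (k + 10) (k + 4) := by
  rcases hB.mem_iff.1 hl with h | h
  · exact Or.inr (isRigidEnd_enlarge_aux h fun h' => hB.not_mem_both h h')
  · exact Or.inl (isRigidEnd_enlarge_aux h fun h' => hB.not_mem_both h' h)

/-- The renaming that sends `y` to `s` and keeps the other indices below `k`. -/
def transfer (k y s i : ℕ) : Option ℕ :=
  -- The old `s` is erased, so that `y` is the only index sent to `s`, as a marker requires.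
  if i = y then some s else if i = s then none else if i < k then some i else none

theorem filterMap_flatMap_inflate {π : ℕ → Option ℕ} {L : List ℕ}
    (h : ∀ i ∈ L, (inflate k r l i).filterMap π = [i]) :
    (L.flatMap (inflate k r l)).filterMap π = L := by
  induction L with
  | nil => rfl
  | cons a L ih =>
    rw [List.flatMap_cons, List.filterMap_append, h a (by simp),
      ih fun i hi => h i (by simp [hi])]
    rfl

theorem filterMap_transfer_self {y s : ℕ} {L : List ℕ} (hL : ∀ i ∈ L, i < k) (hs : s ∉ L)
    (hy : k ≤ y) : L.filterMap (transfer k y s) = L := by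
  induction L with
  | nil => rfl
  | cons a L ih =>
    have h1 := hL a (by simp)
    have h2 : a ≠ s := fun h => hs (by simp [h])
    rw [List.filterMap_cons_some (b := a), ih (fun i hi => hL i (by simp [hi]))
      fun h => hs (by simp [h])]
    simp only [transfer]
    rw [if_neg (by omega), if_neg h2, if_pos h1]

theorem filterMap_transfer_new {y s : ℕ} {L : List ℕ} (hL : ∀ i ∈ L, k ≤ i ∧ i ≠ y) :
    L.filterMap (transfer k y s) = [] := by
  rw [List.filterMap_eq_nil_iff]
  intro i hi
  obtain ⟨h1, h2⟩ := hL i hi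
  simp only [transfer]
  rw [if_neg h2, if_neg (show ¬ i < k by omega)]
  split_ifs <;> rfl

theorem transfer_self {y s : ℕ} : transfer k y s y = some s := by simp [transfer]

theorem transfer_target {y s : ℕ} (hy : k ≤ y) (hs : s < k) : transfer k y s s = none := by
  simp only [transfer]
  rw [if_neg (by omega)]
  simp

theorem transfer_old {y s i : ℕ} (hy : k ≤ y) (hi : i < k) (h : i ≠ s) :
    transfer k y s i = some i := by
  simp only [transfer]
  rw [if_neg (by omega), if_neg h, if_pos hi]

theorem transfer_new {y s i : ℕ} (hi : k ≤ i) (h : i ≠ y) : transfer k y s i = none := by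
  simp only [transfer]
  rw [if_neg h, if_neg (show ¬ i < k by omega)]
  split_ifs <;> rfl

theorem filterMap_transfer_inflate_start {y i : ℕ} (hy : y = k ∨ y = k + 2) (hr : r < k)
    (hi : i < k) : (inflate k r l i).filterMap (transfer k y r) = [i] := by
  have hyk : k ≤ y := by omega
  have h3 : (if i = l then [k + 5, k + 4, k + 3] else []).filterMap (transfer k y r) = [] :=
    filterMap_transfer_new fun j hj => by
      split_ifs at hj
      · simp at hj; omega
      · simp at hj
  rw [inflate, List.filterMap_append, h3, List.filterMap_append, List.append_nil]
  by_cases h : i = r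
  · subst h
    rw [if_pos rfl]
    rcases hy with rfl | rfl
    · simp [transfer_self, transfer_target hyk hr,
        transfer_new (k := y) (y := y) (s := i) (i := y + 1) (by omega) (by omega),
        transfer_new (k := y) (y := y) (s := i) (i := y + 2) (by omega) (by omega)]
    · simp [transfer_self, transfer_target hyk hr,
        transfer_new (k := k) (y := k + 2) (s := i) (i := k) (by omega) (by omega),
        transfer_new (k := k) (y := k + 2) (s := i) (i := k + 1) (by omega) (by omega)]
  · rw [if_neg h]
    simp [transfer_old hyk hi h]

theorem filterMap_transfer_inflate_end {y i : ℕ} (hy : y = k + 3 ∨ y = k + 5) (hl : l < k)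
    (hi : i < k) : (inflate k r l i).filterMap (transfer k y l) = [i] := by
  have hyk : k ≤ y := by omega
  have h3 : (if i = r then [k, k + 1, k + 2] else []).filterMap (transfer k y l) = [] :=
    filterMap_transfer_new fun j hj => by
      split_ifs at hj
      · simp at hj; omega
      · simp at hj
  rw [inflate, List.filterMap_append, List.filterMap_append, h3, List.nil_append]
  by_cases h : i = l
  · subst h
    rw [if_pos rfl]
    rcases hy with rfl | rfl
    · simp [transfer_self, transfer_target hyk hl,
        transfer_new (k := k) (y := k + 3) (s := i) (i := k + 4) (by omega) (by omega),
        transfer_new (k := k) (y := k + 3) (s := i) (i := k + 5) (by omega) (by omega)]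
    · simp [transfer_self, transfer_target hyk hl,
        transfer_new (k := k) (y := k + 5) (s := i) (i := k + 4) (by omega) (by omega),
        transfer_new (k := k) (y := k + 5) (s := i) (i := k + 3) (by omega) (by omega)]
  · rw [if_neg h]
    simp [transfer_old hyk hi h]

theorem filterMap_transfer_enlargeSide {y s : ℕ} (hy : y < k + 6)
    (h : ∀ i ∈ A, (inflate k r l i).filterMap (transfer k y s) = [i]) :
    (enlargeSide k r l A).filterMap (transfer k y s) = A := by
  rw [enlargeSide, List.filterMap_append, filterMap_flatMap_inflate h, filterMap_transfer_new,
    List.nil_append]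
  intro i hi
  simp only [separators, List.mem_append] at hi
  rcases hi with hi | hi <;> split_ifs at hi <;> simp at hi <;> omega

theorem isMarker_of_transfer {y s : ℕ} {N : List ℕ} (hB : BlockBalanced A B Z)
    (hk : ∀ i ∈ Z, i < k) (hy : y < k + 6)
    (hN : ∀ i ∈ N, k ≤ i ∧ i ≠ y)
    (h : ∀ i < k, (inflate k r l i).filterMap (transfer k y s) = [i])
    (hZ : (enlarge k Z).filterMap (transfer k y s) = Z) :
    IsMarker (sandwich A B [] Z []) (enlargeSide k r l A) (enlargeSide k r l B) (enlarge k Z) N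
      y := by
  refine ⟨transfer k y s, ⟨s, transfer_self, ?_⟩, fun i hi => transfer_new (hN i hi).1 (hN i hi).2,
    ?_⟩
  · intro i hi
    simp only [transfer] at hi
    split_ifs at hi with h1 h2 h3
    · exact h1
    · exact absurd (Option.some.inj hi) h2
  · rw [filterMap_transfer_enlargeSide hy fun i hi => h i (hk i (hB.mem_iff.2 (Or.inl hi))),
      filterMap_transfer_enlargeSide hy fun i hi => h i (hk i (hB.mem_iff.2 (Or.inr hi))), hZ]

/-- Apart from letters that get erased, `y` is adjacent to `r` both in the frame and at the
beginning of the block, so `y` can take over the role of `r` and the original word results. -/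
theorem isMarker_start {y : ℕ} {N : List ℕ} (hB : BlockBalanced A B Z) (hk : ∀ i ∈ Z, i < k)
    (hr : Z.head? = some r) (hy : y = k ∨ y = k + 2) (hN : ∀ i ∈ N, k ≤ i ∧ i ≠ y) :
    IsMarker (sandwich A B [] Z []) (enlargeSide k r l A) (enlargeSide k r l B) (enlarge k Z) N
      y := by
  have hrk : r < k := hk r (List.mem_of_head? hr)
  refine isMarker_of_transfer hB hk (by omega) hN
    (fun i hi => filterMap_transfer_inflate_start hy hrk hi) ?_
  rcases Z with _ | ⟨r', R⟩
  · simp at hr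
  obtain rfl : r' = r := by simpa using hr
  have h1 : R.filterMap (transfer k y r') = R :=
    filterMap_transfer_self (fun i hi => hk i (by simp [hi])) (List.nodup_cons.1 hB.nodup).1
      (by omega)
  rw [enlarge, List.filterMap_append, List.filterMap_append,
    filterMap_transfer_new (L := [k + 11, k + 4, k + 10, k + 5, k + 9, k + 3])
      (fun i hi => by simp at hi; omega),
    List.filterMap_cons_none (transfer_target (by omega) hrk), h1]
  rcases hy with rfl | rfl
  · rw [List.filterMap_cons_some transfer_self,
      filterMap_transfer_new fun i hi => by simp at hi; omega]
    simp
  · rw [show [k, k + 6, k + 2, k + 7, k + 1, k + 8] = [k, k + 6] ++ ((k + 2) :: [k + 7, k + 1, k + 8])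
      from rfl, List.filterMap_append, List.filterMap_cons_some transfer_self,
      filterMap_transfer_new fun i hi => by simp at hi; omega,
      filterMap_transfer_new fun i hi => by simp at hi; omega]
    simp

theorem isMarker_end {y : ℕ} {N : List ℕ} (hB : BlockBalanced A B Z) (hk : ∀ i ∈ Z, i < k)
    (hl : Z.getLast? = some l) (hy : y = k + 3 ∨ y = k + 5) (hN : ∀ i ∈ N, k ≤ i ∧ i ≠ y) :
    IsMarker (sandwich A B [] Z []) (enlargeSide k r l A) (enlargeSide k r l B) (enlarge k Z) N
      y := by
  have hlk : l < k := hk l (List.mem_of_getLast? hl)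
  refine isMarker_of_transfer hB hk (by omega) hN
    (fun i hi => filterMap_transfer_inflate_end hy hlk hi) ?_
  rcases List.eq_nil_or_concat Z with rfl | ⟨R, l', rfl⟩
  · simp at hl
  rw [List.concat_eq_append] at *
  obtain rfl : l' = l := by simpa using hl
  have hnd := hB.nodup
  have h0 : l' ∉ R := fun h => by
    simp only [List.nodup_append] at hnd
    exact hnd.2.2 l' h l' (by simp) rfl
  have h1 : R.filterMap (transfer k y l') = R :=
    filterMap_transfer_self (fun i hi => hk i (by simp [hi])) h0 (by omega)
  rw [enlarge, List.filterMap_append, List.filterMap_append, List.filterMap_append,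
    filterMap_transfer_new (L := [k, k + 6, k + 2, k + 7, k + 1, k + 8])
      (fun i hi => by simp at hi; omega), h1,
    List.filterMap_cons_none (transfer_target (by omega) hlk)]
  rcases hy with rfl | rfl
  · rw [show [k + 11, k + 4, k + 10, k + 5, k + 9, k + 3] =
      [k + 11, k + 4, k + 10, k + 5, k + 9] ++ ((k + 3) :: []) from rfl, List.filterMap_append,
      List.filterMap_cons_some transfer_self,
      filterMap_transfer_new (L := [k + 11, k + 4, k + 10, k + 5, k + 9])
        fun i hi => by simp at hi; omega]
    simp
  · rw [show [k + 11, k + 4, k + 10, k + 5, k + 9, k + 3] =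
      [k + 11, k + 4, k + 10] ++ ((k + 5) :: [k + 9, k + 3]) from rfl, List.filterMap_append,
      List.filterMap_cons_some transfer_self,
      filterMap_transfer_new (L := [k + 11, k + 4, k + 10]) fun i hi => by simp at hi; omega,
      filterMap_transfer_new (L := [k + 9, k + 3]) fun i hi => by simp at hi; omega]
    simp

end markers

/-! ### Conclusion -/

/-- The factor monoid of an alternating sandwich word generates a variety whose lattice of
subvarieties is not distributive. -/
theorem not_isDistributiveLattice_of_isAlternating {w : Word} {A B Z : List ℕ}
    (hw : w.toList = sandwich A B [] Z []) (hB : BlockBalanced A B Z) (hA : IsAlternating A B Z)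
    (hZ : Z ≠ []) (hAn : A = [] → B.length = 1) (hBn : B = [] → A.length = 1) :
    ¬ IsDistributiveLattice (MonoidVariety.SubvarietyLattice
      (MonoidVariety.generatedBy (MonCat.of (FactorMonoid {w})))) := by
  obtain ⟨k, hk⟩ : ∃ k, ∀ i ∈ Z, i < k :=
    ⟨Z.sum + 1, fun i hi => Nat.lt_succ_of_le (List.le_sum_of_mem hi)⟩
  obtain ⟨r, hr⟩ : ∃ r, Z.head? = some r := ⟨_, List.head?_eq_some_head hZ⟩
  obtain ⟨l, hl⟩ : ∃ l, Z.getLast? = some l := ⟨_, List.getLast?_eq_some_getLast hZ⟩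
  have hrZ : r ∈ Z := List.mem_of_head? hr
  have hlZ : l ∈ Z := List.mem_of_getLast? hl
  refine not_isDistributiveLattice_of_sandwich (Z := enlarge k Z)
    (T := (k + 8) :: (Z ++ [k + 11, k + 4, k + 10, k + 5, k + 9, k + 3]))
    (S := [k, k + 6, k + 2, k + 7, k + 1, k + 8] ++ Z ++ [k + 11])
    (hw ▸ hasPatterns_sandwich hB hA hZ hAn hBn)
    (blockBalanced_enlarge hB hk hrZ hlZ) (isAlternating_enlarge hB hA hr hl)
    (by simp [enlarge]) (by simp [enlarge]) (by simp) (by simp)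
    (isRigidStart_enlarge hB hrZ) (isRigidEnd_enlarge hB hlZ) ?_ ?_ ?_ ?_ <;> rw [hw]
  -- The four markers `a₂ = k + 2`, `c₀ = k + 3`, `a₀ = k`, `c₂ = k + 5` replace the first or the
  -- last letter of `Z`; none of them is among the two letters over which `x` moves in the language
  -- concerned.
  · exact isMarker_start hB hk hr (Or.inr rfl) fun i hi => by simp at hi; omega
  · exact isMarker_end hB hk hl (Or.inl rfl) fun i hi => by simp at hi; omega
  · exact isMarker_start hB hk hr (Or.inl rfl) fun i hi => by simp at hi; omega
  · exact isMarker_end hB hk hl (Or.inr rfl) fun i hi => by simp at hi; omega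

theorem toList_aWord (n m : ℕ) (ρ : Equiv.Perm (Fin (n + m))) : (aWord n m ρ).toList =
    sandwich (List.range n) ((List.range m).map (n + ·)) []
      (List.ofFn fun i => (ρ i : ℕ)) [] := by
  have h1 : (List.ofFn fun i : Fin n =>
      FreeMonoid.of (Letter.z i) * FreeMonoid.of (Letter.t i)).prod.toList =
      ztWord (List.range n) := by
    rw [FreeMonoid.toList_prod, ztWord, List.flatMap_def, ← List.map_coe_finRange_eq_range,
      List.ofFn_eq_map, List.map_map, List.map_map]
    rfl
  have h2 : (List.ofFn fun i : Fin (n + m) => FreeMonoid.of (Letter.z (ρ i))).prod.toList =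
      zWord (List.ofFn fun i => (ρ i : ℕ)) := by
    rw [FreeMonoid.toList_prod, zWord, List.ofFn_eq_map, List.ofFn_eq_map, List.map_map,
      List.map_map]
    generalize List.finRange (n + m) = L
    induction L with
    | nil => rfl
    | cons a L ih => simp_all
  have h3 : (List.ofFn fun j : Fin m =>
      FreeMonoid.of (Letter.t (n + j)) * FreeMonoid.of (Letter.z (n + j))).prod.toList =
      tzWord ((List.range m).map (n + ·)) := by
    rw [FreeMonoid.toList_prod, tzWord, List.flatMap_def, ← List.map_coe_finRange_eq_range,
      List.ofFn_eq_map, List.map_map, List.map_map, List.map_map]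
    rfl
  simp only [aWord, FreeMonoid.toList_mul, h1, h2, h3, FreeMonoid.toList_of]
  simp [sandwich, frame]

theorem mainTheorem3 (n m : ℕ) (hnm : |(n : ℤ) - (m : ℤ)| ≤ 1) (hpos : 1 ≤ n + m)
    (ρ : Equiv.Perm (Fin (n + m))) (hρ : IsNMPermutation n m ρ) :
    ¬ IsDistributiveLattice
        (MonoidVariety.SubvarietyLattice
          (MonoidVariety.generatedBy (MonCat.of (FactorMonoid {aWord n m ρ})))) := by
  rw [abs_le] at hnm
  have hrange : ((List.range n) ++ (List.range m).map (n + ·)) = List.range (n + m) :=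
    List.range_add.symm
  refine not_isDistributiveLattice_of_isAlternating (toList_aWord n m ρ) ⟨?_, ?_⟩ ?_ ?_ ?_ ?_
  · exact List.nodup_ofFn.2 fun i j h => ρ.injective (Fin.ext h)
  · rw [hrange, ← List.map_coe_finRange_eq_range, ← List.ofFn_eq_map]
    exact Equiv.Perm.ofFn_comp_perm ρ fun i : Fin (n + m) => (i : ℕ)
  · rw [IsAlternating, List.isChain_ofFn]
    intro i hi
    have hmemA : ∀ j : Fin (n + m), (j : ℕ) < n → (j : ℕ) ∈ List.range n := fun j hj => by
      simpa using hj
    have hmemB : ∀ j : Fin (n + m), n ≤ (j : ℕ) → (j : ℕ) ∈ (List.range m).map (n + ·) := by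
      intro j hj
      rw [List.mem_map]
      exact ⟨j - n, by rw [List.mem_range]; omega, by omega⟩
    rcases hρ ⟨i, by omega⟩ ⟨i + 1, hi⟩ rfl with ⟨h1, h2⟩ | ⟨h1, h2⟩
    · exact Or.inl ⟨hmemA _ h1, hmemB _ h2⟩
    · exact Or.inr ⟨hmemB _ h2, hmemA _ h1⟩
  · rw [Ne, List.ofFn_eq_nil_iff]
    omega
  -- An empty side means `n = 0`, and then `|n - m| ≤ 1` and `1 ≤ n + m` leave only `m = 1`; the
  -- other side is symmetric.
  · intro h
    simp at h ⊢
    omega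
  · intro h
    simp at h ⊢
    omega
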